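/- Let $k$ be a field and let $n\ge 0$, $d\ge 1$ be integers. Let $\mathfrak n$ be the Lie algebra over $k$ freely generated by $x_1,\dots,x_n$ subject to the relations that all expressions involving at least $d$ brackets vanish (the free $d$-step nilpotent Lie algebra on $n$ generators), let $U$ be its universal enveloping algebra, and let $I\subseteq U$ be the two-sided ideal generated by the commutators $[x_i,x_j]$, $1\le i,j\le n$. Then $U/I$ is the polynomial algebra $k[x_1,\dots,x_n]$, via $x_i\mapsto x_i$. Let ${}_{U/I}k$ and ${}_Uk$ denote the field $k$ regarded as a left $U/I$-module, respectively as a left $U$-module, through the $k$-algebra maps $U\to U/I\to k$, $x_i\mapsto 0$. For an object $M$ of the unbounded derived category $D(U/I)$ of left $U/I$-modules, let $\langle M\rangle_{U/I}$ be the smallest thick subcategory of $D(U/I)$ containing $M$ (closed under shifts, cones and direct summands), and let $\overline{\langle M\rangle}_{U/I}$ be the smallest localizing subcategory of $D(U/I)$ containing $M$ (closed under shifts, cones and arbitrary set-indexed direct sums). Then $$\langle {}_{U/I}k\rangle_{U/I}=\langle U/I\otimes^L_U {}_Uk\rangle_{U/I}\qquad\text{and}\qquad \overline{\langle {}_{U/I}k\rangle}_{U/I}=\overline{\langle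 U/I\otimes^L_U {}_Uk\rangle}_{U/I}.$$ -/

import Mathlib

open CategoryTheory TensorProduct

universe u w

/-! ### Extension of scalars along a homomorphism of noncommutative rings -/

section ExtendScalars

variable {A B : Type u} [Ring A] [Ring B] (f : A →+* B)

/-- The `B`-submodule of `B ⊗[ℤ] M` generated by the elements
`b f(a) ⊗ m - b ⊗ a m` (the balancing relations over `A`). -/
def balancedRel (M : Type u) [AddCommGroup M] [Module A M] : Submodule B (B ⊗[ℤ] M) :=
  Submodule.span B
    {t | ∃ (b : B) (a : A) (m : M), t = (b * f a) ⊗ₜ[ℤ] m - b ⊗ₜ[ℤ] (a • m)}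

/-- The left `B`-module `B ⊗_A M`, for a left `A`-module `M` and a ring homomorphism
`f : A → B`, where `A` acts on `B` from the right through `f`. -/
abbrev BalancedTensor (M : Type u) [AddCommGroup M] [Module A M] : Type u :=
  (B ⊗[ℤ] M) ⧸ balancedRel f M

/-- The `B`-linear map `B ⊗_A g : B ⊗_A M → B ⊗_A N`, `b ⊗ m ↦ b ⊗ g m`. -/
noncomputable def BalancedTensor.map {M N : Type u} [AddCommGroup M] [Module A M]
    [AddCommGroup N] [Module A N] (g : M →ₗ[A] N) :
    BalancedTensor f M →ₗ[B] BalancedTensor f N :=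
  Submodule.mapQ _ _
    (TensorProduct.AlgebraTensorModule.map (LinearMap.id : B →ₗ[B] B) (g.restrictScalars ℤ)) (by
      rw [balancedRel, Submodule.span_le]
      rintro _ ⟨b, a, m, rfl⟩
      exact Submodule.subset_span ⟨b, a, g m, by simp⟩)

@[simp]
theorem BalancedTensor.map_mk_tmul {M N : Type u} [AddCommGroup M] [Module A M]
    [AddCommGroup N] [Module A N] (g : M →ₗ[A] N) (b : B) (m : M) :
    BalancedTensor.map f g (Submodule.Quotient.mk (b ⊗ₜ[ℤ] m)) =
      Submodule.Quotient.mk (b ⊗ₜ[ℤ] (g m)) := rfl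

theorem BalancedTensor.hom_ext {M : Type u} [AddCommGroup M] [Module A M]
    {N : Type u} [AddCommGroup N] [Module B N] {g h : BalancedTensor f M →ₗ[B] N}
    (H : ∀ (b : B) (m : M), g (Submodule.Quotient.mk (b ⊗ₜ[ℤ] m)) =
      h (Submodule.Quotient.mk (b ⊗ₜ[ℤ] m))) : g = h := by
  refine LinearMap.ext fun x => ?_
  obtain ⟨x, rfl⟩ := Submodule.Quotient.mk_surjective (balancedRel f M) x
  induction x with
  | zero => simp
  | tmul b m => exact H b m
  | add x y hx hy => rw [Submodule.Quotient.mk_add, map_add, map_add, hx, hy]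

/-- The functor `B ⊗_A - : Mod(A) ⥤ Mod(B)` between categories of left modules. -/
noncomputable def baseChangeFunctor : ModuleCat.{u} A ⥤ ModuleCat.{u} B where
  obj M := ModuleCat.of B (BalancedTensor f M)
  map g := ModuleCat.ofHom (BalancedTensor.map f g.hom)
  map_id M := by
    ext1
    exact BalancedTensor.hom_ext f fun b m => rfl
  map_comp g h := by
    ext1
    exact BalancedTensor.hom_ext f fun b m => rfl

instance : (baseChangeFunctor f).Additive where
  map_add {M N g h} := by
    ext1
    refine BalancedTensor.hom_ext f fun b m => ?_
    exact congrArg (balancedRel f N).mkQ (TensorProduct.tmul_add b (g.hom m) (h.hom m))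

/-- The derived tensor product `B ⊗^L_A M ∈ D(B)` of a left `A`-module `M`: the complex
`B ⊗_A P`, where `P` is a projective resolution of `M`. -/
noncomputable def derivedBaseChange [HasDerivedCategory.{w} (ModuleCat.{u} B)]
    (M : ModuleCat.{u} A) : DerivedCategory (ModuleCat.{u} B) :=
  DerivedCategory.Q.obj
    (((baseChangeFunctor f).mapHomologicalComplex (ComplexShape.up ℤ)).obj
      (projectiveResolution M).cochainComplex)

end ExtendScalars

/-! ### Thick and localizing subcategories generated by an object -/

section Envelopes

open Limits Pretriangulated

variable {C : Type*} [Category* C] [HasZeroObject C] [HasShift C ℤ] [Preadditive C]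
  [∀ (n : ℤ), (shiftFunctor C n).Additive] [Pretriangulated C]

/-- A class of objects is a localizing subcategory if it is triangulated (closed under shifts
and cones) and closed under all direct sums indexed by types in the universe `w`. -/
structure IsLocalizingSubcategory (P : ObjectProperty C) : Prop where
  isTriangulated : P.IsTriangulated
  closedUnderCoproducts : ∀ J : Type w, P.IsClosedUnderColimitsOfShape (Discrete J)

/-- The smallest thick subcategory (triangulated and closed under direct summands) containing
the object `X`. -/
def thickSubcategory (X : C) : ObjectProperty C :=
  (ObjectProperty.singleton X).triangEnvelope

/-- The smallest localizing subcategory containing the object `X`. -/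
def localizingSubcategory (X : C) : ObjectProperty C :=
  fun Y => ∀ P : ObjectProperty C, IsLocalizingSubcategory.{w} P → P X → P Y

end Envelopes

/-! ### The free nilpotent Lie algebra, its enveloping algebra, and the residue modules -/

section FreeNilpotent

variable (k : Type u) [Field k] (n d : ℕ)

/-- The Lie algebra freely generated by `x₁, …, xₙ` subject to the relations that all
expressions involving at least `d` brackets vanish: the quotient of the free Lie algebra by
the `d`-th term of its lower central series (which starts with the whole algebra in index `0`). -/
abbrev FreeNilpotentLie : Type u :=
  FreeLieAlgebra k (Fin n) ⧸
    LieModule.lowerCentralSeries k (FreeLieAlgebra k (Fin n)) (FreeLieAlgebra k (Fin n)) d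

/-- The universal enveloping algebra `U` of the free nilpotent Lie algebra. -/
abbrev EnvNilpotent : Type u :=
  UniversalEnvelopingAlgebra k (FreeNilpotentLie k n d)

/-- The generator `xᵢ` of `U`. -/
noncomputable def envGen (i : Fin n) : EnvNilpotent k n d :=
  UniversalEnvelopingAlgebra.ι k
    (LieSubmodule.Quotient.mk (FreeLieAlgebra.of k i) : FreeNilpotentLie k n d)

/-- The two-sided ideal `I` of `U` generated by the commutators `[xᵢ, xⱼ]`. -/
noncomputable def commutatorIdeal : TwoSidedIdeal (EnvNilpotent k n d) :=
  TwoSidedIdeal.span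
    {c | ∃ i j : Fin n, c = envGen k n d i * envGen k n d j - envGen k n d j * envGen k n d i}

/-- The quotient algebra `U/I`. -/
abbrev EnvQuotient : Type u := (commutatorIdeal k n d).ringCon.Quotient

/-- The quotient map `U → U/I`. -/
noncomputable def envQuotientMap : EnvNilpotent k n d →ₐ[k] EnvQuotient k n d :=
  (commutatorIdeal k n d).ringCon.mkₐ k

attribute [local instance 100] LieRing.ofAssociativeRing

/-- The algebra map `U → k` with `xᵢ ↦ 0`. -/
noncomputable def envAugmentation : EnvNilpotent k n d →ₐ[k] k :=
  UniversalEnvelopingAlgebra.lift k (0 : FreeNilpotentLie k n d →ₗ⁅k⁆ k)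

theorem commutatorIdeal_ringCon_le_ker :
    (commutatorIdeal k n d).ringCon ≤ RingCon.ker (envAugmentation k n d).toRingHom := by
  have h : commutatorIdeal k n d ≤ TwoSidedIdeal.ker (envAugmentation k n d) := by
    refine TwoSidedIdeal.span_le.2 ?_
    rintro _ ⟨i, j, rfl⟩
    rw [SetLike.mem_coe, TwoSidedIdeal.mem_ker, map_sub, map_mul, map_mul, mul_comm, sub_self]
  intro x y hxy
  have := h ((TwoSidedIdeal.rel_iff _ x y).1 hxy)
  rw [TwoSidedIdeal.mem_ker, map_sub, sub_eq_zero] at this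
  exact this

/-- The algebra map `U/I → k` with `xᵢ ↦ 0`. -/
noncomputable def quotientAugmentation : EnvQuotient k n d →ₐ[k] k :=
  (commutatorIdeal k n d).ringCon.liftₐ (envAugmentation k n d)
    (commutatorIdeal_ringCon_le_ker k n d)

/-- The left `U/I`-module `k`, on which every `xᵢ` acts as zero. -/
noncomputable def quotientResidueModule : ModuleCat.{u} (EnvQuotient k n d) :=
  (ModuleCat.restrictScalars (quotientAugmentation k n d).toRingHom).obj (ModuleCat.of k k)

/-- The left `U`-module `k`, on which every `xᵢ` acts as zero. -/
noncomputable def envResidueModule : ModuleCat.{u} (EnvNilpotent k n d) :=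
  (ModuleCat.restrictScalars (envQuotientMap k n d).toRingHom).obj (quotientResidueModule k n d)

end FreeNilpotent

/-! ### Left regularity of Lie algebra elements in the enveloping algebra -/

section EnvelopingAlgebra

attribute [local instance 100] LieRing.ofAssociativeRing

namespace UniversalEnvelopingAlgebra

section General

variable {k : Type*} [CommRing k] {L : Type*} [LieRing L] [LieAlgebra k L]

/-! Write `L` for the free nilpotent Lie algebra, `B = U/I` and `𝔪` for the kernel of `B → k`. The
proof rests on two ideals being generated by regular sequences whose members are each central modulo
the previous ones (`CentralChain`): `I` in `U`, and `𝔪` in `B`. If `J` is such an ideal and `K` a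
complex of projectives, then `K/JK` is built from `K` by iterated cones of multiplication maps
(`CentralChain.reductionComplex_mem`).

For `𝔪` the sequence is `x₁, …, xₙ` in a polynomial ring. For `I`, which is the kernel of `U(L) →
U(L/[L,L])`, one climbs from `0` to `[L,L]` through ideals of `L`, adding one element `z` at a time
that is central modulo the ideal `b` already reached. Regularity then says that a nonzero element of
a finite-dimensional nilpotent Lie algebra is left regular in its enveloping algebra
(`eq_zero_of_ι_mul_eq_zero`). This avoids a full PBW theorem: `L = H ⊕ kx` acts on `U(H)[t]` as it
should act on the elements `b xⁱ`, and induction on the dimension applies to `H`.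

Let `P` be a projective resolution of `k` over `U`. As a complex of `U`-modules, `B ⊗ P` is `P/IP`;
by the cones its cohomology is bounded, of finite length, and killed by a power of the augmentation
ideal. Dévissage along truncations and composition series, whose factors are all `k`, puts `B ⊗^L k`
in every triangulated, isomorphism-closed class containing `k`.

Conversely put `K = B ⊗ P`. By the cones `K/𝔪K` lies in what `K` generates. Since `K` vanishes in
positive degrees and surjects onto `k`, the module `k` is a retract of `K/𝔪K`. This settles the
thick case. A localizing class is not assumed closed under summands; an Eilenberg swindle supplies
this, using that countable coproducts of `K/𝔪K` exist in the derived category because it is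
represented by a bounded above complex of projectives. -/

theorem ι_mul_sub_mul (x y : L) : ι k x * ι k y - ι k y * ι k x = ι k ⁅x, y⁆ := by
  rw [LieHom.map_lie, LieRing.of_associative_ring_bracket]

/-- By the universal property, lifting `ι` to the generated subalgebra gives a section of the
inclusion. -/
theorem adjoin_range_ι : Algebra.adjoin k (Set.range (ι k : L → UniversalEnvelopingAlgebra k L)) =
    ⊤ := by
  set A := Algebra.adjoin k (Set.range (ι k : L → UniversalEnvelopingAlgebra k L)) with hA
  let f : L →ₗ⁅k⁆ A :=
    { toFun := fun x => ⟨ι k x, Algebra.subset_adjoin ⟨x, rfl⟩⟩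
      map_add' := fun x y => Subtype.ext (by simp only [map_add]; rfl)
      map_smul' := fun c x => Subtype.ext (by simp only [map_smul]; rfl)
      map_lie' := fun {x y} => Subtype.ext (by simp only [LieHom.map_lie]; rfl) }
  have h : A.val.comp (lift k f) = AlgHom.id k _ := by
    ext x
    change ((lift k f (ι k x) : A) : UniversalEnvelopingAlgebra k L) = ι k x
    rw [lift_ι_apply]
    rfl
  rw [eq_top_iff]
  intro u _
  have hu : ((lift k f u : A) : UniversalEnvelopingAlgebra k L) = u := DFunLike.congr_fun h u
  rw [← hu]
  exact (lift k f u).2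

@[elab_as_elim]
theorem induction {p : UniversalEnvelopingAlgebra k L → Prop}
    (algebraMap : ∀ r, p (algebraMap k _ r)) (ι : ∀ x, p (ι k x))
    (mul : ∀ a b, p a → p b → p (a * b)) (add : ∀ a b, p a → p b → p (a + b))
    (u : UniversalEnvelopingAlgebra k L) : p u := by
  have hu : u ∈ Algebra.adjoin k (Set.range (UniversalEnvelopingAlgebra.ι k : L → _)) := by
    rw [adjoin_range_ι]; trivial
  induction hu using Algebra.adjoin_induction with
  | mem x hx => obtain ⟨y, rfl⟩ := hx; exact ι y
  | algebraMap r => exact algebraMap r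
  | add x y _ _ hx hy => exact add x y hx hy
  | mul x y _ _ hx hy => exact mul x y hx hy

/-- The algebra map `U(L) → U(L)[ε]` given by `x ↦ x + D(x) ε` for a derivation `D` of `L`. -/
noncomputable def derivationLift (D : LieDerivation k L L) :
    UniversalEnvelopingAlgebra k L →ₐ[k] DualNumber (UniversalEnvelopingAlgebra k L) :=
  lift k
    { toFun := fun x => TrivSqZeroExt.inl (ι k x) + TrivSqZeroExt.inr (ι k (D x))
      map_add' := fun x y => by
        ext <;> simp
      map_smul' := fun c x => by
        ext <;> simp
      map_lie' := fun {x y} => by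
        rw [LieRing.of_associative_ring_bracket]
        ext
        · simp [-ι_apply, LieRing.of_associative_ring_bracket]
        · simp [-ι_apply, LieRing.of_associative_ring_bracket]
          abel }

theorem fst_derivationLift (D : LieDerivation k L L) (u : UniversalEnvelopingAlgebra k L) :
    (derivationLift D u).fst = u := by
  have h : (TrivSqZeroExt.fstHom k (UniversalEnvelopingAlgebra k L)
      (UniversalEnvelopingAlgebra k L)).comp (derivationLift D) = AlgHom.id k _ := by
    ext x
    change (derivationLift D (ι k x)).fst = ι k x
    rw [derivationLift, lift_ι_apply]
    simp [-ι_apply]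
  exact DFunLike.congr_fun h u

/-- The derivation of `U(L)` extending a derivation `D` of `L`. -/
noncomputable def extendDerivation (D : LieDerivation k L L) :
    UniversalEnvelopingAlgebra k L →ₗ[k] UniversalEnvelopingAlgebra k L where
  -- The `ε`-coefficient of an algebra map `u ↦ u + D(u) ε` obeys the Leibniz rule; dual numbers
  -- thus bring derivations under the universal property.
  toFun u := (derivationLift D u).snd
  map_add' u v := by rw [map_add]; rfl
  map_smul' c u := by rw [map_smul]; rfl

@[simp]
theorem extendDerivation_ι (D : LieDerivation k L L) (x : L) :
    extendDerivation D (ι k x) = ι k (D x) := by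
  change (derivationLift D (ι k x)).snd = _
  rw [derivationLift, lift_ι_apply]
  simp [-ι_apply]

@[simp]
theorem extendDerivation_mul (D : LieDerivation k L L) (u v : UniversalEnvelopingAlgebra k L) :
    extendDerivation D (u * v) = u * extendDerivation D v + extendDerivation D u * v := by
  change (derivationLift D (u * v)).snd = _
  rw [map_mul, TrivSqZeroExt.snd_mul, fst_derivationLift, fst_derivationLift]
  rfl

@[simp]
theorem extendDerivation_algebraMap (D : LieDerivation k L L) (r : k) :
    extendDerivation D (algebraMap k _ r) = 0 := by
  change (derivationLift D (algebraMap k _ r)).snd = 0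
  rw [AlgHom.commutes]
  rfl

/-- The algebra map `U(L) → U(L')` induced by a Lie algebra map `L → L'`. -/
noncomputable def map {L' : Type*} [LieRing L'] [LieAlgebra k L'] (f : L →ₗ⁅k⁆ L') :
    UniversalEnvelopingAlgebra k L →ₐ[k] UniversalEnvelopingAlgebra k L' :=
  lift k ((ι k).comp f)

@[simp]
theorem map_ι {L' : Type*} [LieRing L'] [LieAlgebra k L'] (f : L →ₗ⁅k⁆ L') (x : L) :
    map f (ι k x) = ι k (f x) := by
  rw [map, lift_ι_apply]
  rfl

end General

section CodimensionOne

variable {k : Type*} [CommRing k] {L : Type*} [LieRing L] [LieAlgebra k L]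
  (H : LieIdeal k L) (lam : L →ₗ[k] k) (hlam : ∀ y, y ∈ H ↔ lam y = 0)
  (x : L) (hx : lam x = 1)

/-- The derivation of an ideal `H` of `L` given by the bracket with an element of `L`. -/
def adIdeal : LieDerivation k H H where
  toFun h := ⟨⁅x, (h : L)⁆, H.lie_mem h.2⟩
  map_add' a b := Subtype.ext (by simp)
  map_smul' c a := Subtype.ext (by simp)
  leibniz' a b := Subtype.ext (by
    simp only [LinearMap.coe_mk, AddHom.coe_mk, LieSubmodule.coe_sub]
    change ⁅x, ⁅(a : L), (b : L)⁆⁆ = ⁅(a : L), ⁅x, (b : L)⁆⁆ - ⁅(b : L), ⁅x, (a : L)⁆⁆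
    rw [leibniz_lie, ← lie_skew (b : L) ⁅x, (a : L)⁆]
    abel)

@[simp]
theorem coe_adIdeal (h : H) : (adIdeal H x h : L) = ⁅x, (h : L)⁆ := rfl

/-- The projection `L → H` along `x`, where `L = H ⊕ k x`. -/
def projIdeal : L →ₗ[k] H where
  toFun y := ⟨y - lam y • x, (hlam _).2 (by simp [hx])⟩
  map_add' a b := Subtype.ext (by simp [add_smul]; abel)
  map_smul' c a := Subtype.ext (by simp [mul_smul, smul_sub])

@[simp]
theorem coe_projIdeal (y : L) : (projIdeal H lam hlam x hx y : L) = y - lam y • x := rfl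

/-- Left multiplication by an element of `U(H)` on `U(H)[t]`. -/
noncomputable def polyMul : UniversalEnvelopingAlgebra k H →ₗ[k]
    Module.End k (ℕ →₀ UniversalEnvelopingAlgebra k H) where
  toFun b := Finsupp.mapRange.linearMap (LinearMap.mulLeft k b)
  map_add' a b := Finsupp.lhom_ext fun i c => by
    simp [add_mul, -Finsupp.single_mul]
  map_smul' c a := Finsupp.lhom_ext fun i b => by
    simp [-Finsupp.single_mul]

/-- The operator `b tⁱ ↦ b tⁱ⁺¹ + [x, b] tⁱ` on `U(H)[t]`. -/
noncomputable def polyShift : Module.End k (ℕ →₀ UniversalEnvelopingAlgebra k H) :=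
  Finsupp.lmapDomain _ k Nat.succ +
    Finsupp.mapRange.linearMap (extendDerivation (adIdeal H x))

@[simp]
theorem polyMul_single (b c : UniversalEnvelopingAlgebra k H) (i : ℕ) :
    polyMul H b (Finsupp.single i c) = Finsupp.single i (b * c) := by
  simp [polyMul, -Finsupp.single_mul]

@[simp]
theorem polyShift_single (c : UniversalEnvelopingAlgebra k H) (i : ℕ) :
    polyShift H x (Finsupp.single i c) =
      Finsupp.single (i + 1) c + Finsupp.single i (extendDerivation (adIdeal H x) c) := by
  simp [polyShift]

theorem polyMul_mul (b c : UniversalEnvelopingAlgebra k H) :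
    polyMul H (b * c) = polyMul H b * polyMul H c := by
  refine Finsupp.lhom_ext fun i a => ?_
  simp [mul_assoc, -Finsupp.single_mul]

/-- The operator form of `x b = b x + [x, b]`; this relation makes `polyRep` a Lie algebra map. -/
theorem polyShift_mul_polyMul (b : UniversalEnvelopingAlgebra k H) :
    polyShift H x * polyMul H b =
      polyMul H b * polyShift H x + polyMul H (extendDerivation (adIdeal H x) b) := by
  refine Finsupp.lhom_ext fun i a => ?_
  simp only [Module.End.mul_apply, LinearMap.add_apply, polyMul_single, polyShift_single,
    extendDerivation_mul, map_add, Finsupp.single_add]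
  abel

/-- The action of `L = H ⊕ k x` on `U(H)[t]`. -/
noncomputable def polyRep (hbr : ∀ y y' : L, ⁅y, y'⁆ ∈ H) :
    L →ₗ⁅k⁆ Module.End k (ℕ →₀ UniversalEnvelopingAlgebra k H) where
  toFun y := polyMul H (ι k (projIdeal H lam hlam x hx y)) + lam y • polyShift H x
  map_add' a b := by simp only [map_add, add_smul]; abel
  map_smul' c a := by simp only [map_smul, smul_add, RingHom.id_apply, smul_eq_mul, mul_smul]
  map_lie' := fun {y y'} => by
    have h0 : lam ⁅y, y'⁆ = 0 := (hlam _).1 (hbr y y')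
    -- Expand the bracket of `y = h + λx` and `y' = h' + λ'x`: the part `[x, x]` vanishes, leaving
    -- `[h, h']` and two cross terms.
    have h1 : projIdeal H lam hlam x hx ⁅y, y'⁆ =
        ⁅projIdeal H lam hlam x hx y, projIdeal H lam hlam x hx y'⁆ +
          lam y • adIdeal H x (projIdeal H lam hlam x hx y') -
          lam y' • adIdeal H x (projIdeal H lam hlam x hx y) := by
      apply Subtype.ext
      change ⁅y, y'⁆ - lam ⁅y, y'⁆ • x = ⁅y - lam y • x, y' - lam y' • x⁆ +
        lam y • ⁅x, y' - lam y' • x⁆ - lam y' • ⁅x, y - lam y • x⁆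
      simp only [h0, lie_sub, sub_lie, lie_smul, smul_lie, lie_self, smul_zero, sub_zero, zero_smul]
      rw [← lie_skew y x, smul_neg]
      abel
    rw [h0, zero_smul, add_zero, h1, LieRing.of_associative_ring_bracket, map_sub, map_add,
      ← ι_mul_sub_mul, map_sub, map_add, map_smul, map_smul, map_sub, polyMul_mul, polyMul_mul,
      map_smul, map_smul, ← extendDerivation_ι, ← extendDerivation_ι]
    simp only [add_mul, mul_add, smul_mul_assoc, mul_smul_comm, polyShift_mul_polyMul, smul_add,
      smul_comm (lam y) (lam y')]
    abel

/-- The map `U(H)[t] → U(L)`, `b tⁱ ↦ b xⁱ`. -/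
noncomputable def polyEval : (ℕ →₀ UniversalEnvelopingAlgebra k H) →ₗ[k]
    UniversalEnvelopingAlgebra k L :=
  Finsupp.lsum k fun i => LinearMap.mulRight k (ι k x ^ i) ∘ₗ (map H.incl).toLinearMap

@[simp]
theorem polyEval_single (i : ℕ) (b : UniversalEnvelopingAlgebra k H) :
    polyEval H x (Finsupp.single i b) = map H.incl b * ι k x ^ i := by
  simp [polyEval]

theorem map_extendDerivation_adIdeal (b : UniversalEnvelopingAlgebra k H) :
    map H.incl (extendDerivation (adIdeal H x) b) =
      ι k x * map H.incl b - map H.incl b * ι k x := by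
  induction b using UniversalEnvelopingAlgebra.induction with
  | algebraMap r => simp [Algebra.commutes, -ι_apply]
  | ι h =>
    rw [extendDerivation_ι, map_ι, map_ι, ι_mul_sub_mul]
    rfl
  | mul a b ha hb =>
    rw [extendDerivation_mul, map_add, map_mul, map_mul, ha, hb, map_mul]
    noncomm_ring
  | add a b ha hb =>
    rw [map_add, map_add, ha, hb, map_add]
    noncomm_ring

/-- The operators of `polyRep` were read off from left multiplication on the elements `b xⁱ`, so
`polyEval` intertwines the two actions; it suffices to check this on single terms. -/
theorem polyEval_polyRep (hbr : ∀ y y' : L, ⁅y, y'⁆ ∈ H) (y : L)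
    (v : ℕ →₀ UniversalEnvelopingAlgebra k H) :
    polyEval H x (polyRep H lam hlam x hx hbr y v) = ι k y * polyEval H x v := by
  have h : polyEval H x ∘ₗ polyRep H lam hlam x hx hbr y =
      LinearMap.mulLeft k (ι k y) ∘ₗ polyEval H x := by
    refine Finsupp.lhom_ext fun i b => ?_
    have hy : ι k y = ι k (H.incl (projIdeal H lam hlam x hx y)) + lam y • ι k x := by
      rw [← map_smul, ← map_add]
      congr 1
      change y = y - lam y • x + lam y • x
      abel
    change polyEval H x ((polyMul H (ι k (projIdeal H lam hlam x hx y)) +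
      lam y • polyShift H x) (Finsupp.single i b)) = ι k y * polyEval H x (Finsupp.single i b)
    rw [hy, LinearMap.add_apply, LinearMap.smul_apply, polyMul_single, polyShift_single, map_add,
      map_smul, map_add, polyEval_single, polyEval_single, polyEval_single, polyEval_single,
      map_extendDerivation_adIdeal, map_mul, map_ι, add_mul, smul_mul_assoc, pow_succ']
    congr 1
    · rw [mul_assoc]
    · congr 1
      noncomm_ring
  exact DFunLike.congr_fun h v

theorem polyEval_lift_polyRep (hbr : ∀ y y' : L, ⁅y, y'⁆ ∈ H) (u : UniversalEnvelopingAlgebra k L)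
    (v : ℕ →₀ UniversalEnvelopingAlgebra k H) :
    polyEval H x (lift k (polyRep H lam hlam x hx hbr) u v) = u * polyEval H x v := by
  induction u using UniversalEnvelopingAlgebra.induction generalizing v with
  | algebraMap r => simp [Algebra.algebraMap_eq_smul_one]
  | ι y => rw [lift_ι_apply, polyEval_polyRep]
  | mul a b ha hb => rw [map_mul, Module.End.mul_apply, ha, hb, mul_assoc]
  | add a b ha hb => rw [map_add, LinearMap.add_apply, map_add, ha, hb, add_mul]

/-- Acting on `1 ∈ U(H)[t]` embeds `U(L)` in `U(H)[t]`, because `polyEval` sends `u · 1` back to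
`u`. Injectivity of the operator of `y` is therefore enough for left regularity. -/
theorem eq_zero_of_ι_mul_eq_zero_of_injective (hbr : ∀ y y' : L, ⁅y, y'⁆ ∈ H) (y : L)
    (hy : ∀ v, polyRep H lam hlam x hx hbr y v = 0 → v = 0) (u : UniversalEnvelopingAlgebra k L)
    (hu : ι k y * u = 0) : u = 0 := by
  have h1 : lift k (polyRep H lam hlam x hx hbr) u (Finsupp.single 0 1) = 0 := by
    apply hy
    rw [← lift_ι_apply k (polyRep H lam hlam x hx hbr), ← Module.End.mul_apply, ← map_mul, hu,
      map_zero, LinearMap.zero_apply]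
  have h2 := polyEval_lift_polyRep H lam hlam x hx hbr u (Finsupp.single 0 1)
  rw [h1, map_zero, polyEval_single, map_one, pow_zero, mul_one, mul_one] at h2
  exact h2.symm

/-- The derivation term preserves the degree in `t`, so the leading coefficient of `v` survives one
degree higher. -/
theorem polyShift_injective (v : ℕ →₀ UniversalEnvelopingAlgebra k H)
    (hv : polyShift H x v = 0) : v = 0 := by
  by_contra hne
  have hs : v.support.Nonempty := Finsupp.support_nonempty_iff.2 hne
  set N := v.support.max' hs
  have hN : v N ≠ 0 := Finsupp.mem_support_iff.1 (v.support.max'_mem hs)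
  have hN1 : v (N + 1) = 0 := by
    by_contra h
    have := v.support.le_max' _ (Finsupp.mem_support_iff.2 h)
    change N + 1 ≤ N at this
    lia
  have h := DFunLike.congr_fun hv (N + 1)
  rw [polyShift, LinearMap.add_apply, Finsupp.add_apply, Finsupp.mapRange.linearMap_apply,
    Finsupp.mapRange_apply, hN1, map_zero, add_zero, Finsupp.lmapDomain_apply,
    Finsupp.mapDomain_apply Nat.succ_injective] at h
  exact hN h

end CodimensionOne

/-- Induction on the dimension. As `[L,L] ≠ L`, a hyperplane `H ⊇ [L,L]` exists and is automatically
an ideal. If `z ∈ H`, then `z` acts on `U(H)[t]` coefficientwise and induction applies to `H`;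
otherwise `z` itself spans a complement and acts, up to normalization of `f`, as `polyShift`. -/
theorem eq_zero_of_ι_mul_eq_zero {k : Type*} [Field k] {L : Type*} [LieRing L] [LieAlgebra k L]
    [FiniteDimensional k L] [LieRing.IsNilpotent L] {z : L} (hz : z ≠ 0)
    {u : UniversalEnvelopingAlgebra k L} (hu : ι k z * u = 0) : u = 0 := by
  induction hn : Module.finrank k L using Nat.strong_induction_on generalizing L with
  | _ n ih =>
  have : Nontrivial L := ⟨z, 0, hz⟩
  have hD : (LieAlgebra.derivedSeries k L 1).toSubmodule < ⊤ := by
    have h := LieAlgebra.derivedSeries_lt_top_of_solvable k L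
    rw [lt_top_iff_ne_top, Ne, LieSubmodule.toSubmodule_eq_top]
    exact h.ne
  obtain ⟨f, hf0, hf⟩ := Submodule.exists_le_ker_of_lt_top _ hD
  have hf' : ∀ y y' : L, f ⁅y, y'⁆ = 0 := fun y y' =>
    hf (LieSubmodule.lie_mem_lie (LieSubmodule.mem_top y) (LieSubmodule.mem_top y'))
  let H : LieIdeal k L :=
    { LinearMap.ker f with lie_mem := fun {y m} _ => hf' y m }
  have hH : ∀ y, y ∈ H ↔ f y = 0 := fun y => Iff.rfl
  -- The complement vector is `z` itself whenever `z ∉ H`, so that its `H`-component is then zero.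
  obtain ⟨x, hx, hxz⟩ : ∃ x, f x ≠ 0 ∧ (f z ≠ 0 → x = z) := by
    by_cases h : f z = 0
    · obtain ⟨x, hx⟩ : ∃ x, f x ≠ 0 := by
        by_contra! h'
        exact hf0 (LinearMap.ext h')
      exact ⟨x, hx, fun h' => absurd h h'⟩
    · exact ⟨z, h, fun _ => rfl⟩
  have hlam : ∀ y, y ∈ H ↔ ((f x)⁻¹ • f) y = 0 := fun y => by simp [hH, hx]
  have hlx : ((f x)⁻¹ • f) x = 1 := by simp [hx]
  have hbr : ∀ y y' : L, ⁅y, y'⁆ ∈ H := fun y y' => hf' y y'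
  refine eq_zero_of_ι_mul_eq_zero_of_injective H _ hlam x hlx hbr z (fun v hv => ?_) u hu
  by_cases hfz : f z = 0
  · have hz' : projIdeal H _ hlam x hlx z = ⟨z, hfz⟩ := Subtype.ext (by simp [hfz])
    have hv' : polyMul H (ι k (⟨z, hfz⟩ : H)) v = 0 := by
      rw [← hz', ← hv]
      simp [polyRep, hfz, -ι_apply]
    have hlt : Module.finrank k H < n := by
      rw [← hn]
      refine Submodule.finrank_lt (s := H.toSubmodule) (fun h => hx ?_)
      have hxH : x ∈ H.toSubmodule := h ▸ Submodule.mem_top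
      exact hxH
    have : LieRing.IsNilpotent H :=
      Function.Injective.lieAlgebra_isNilpotent (f := H.incl) Subtype.val_injective
    ext i
    refine ih _ hlt (z := (⟨z, hfz⟩ : H)) (fun h => hz (congrArg Subtype.val h)) ?_ rfl
    simpa [polyMul, -ι_apply] using DFunLike.congr_fun hv' i
  · obtain rfl := hxz hfz
    refine polyShift_injective H x v ?_
    have hz' : projIdeal H _ hlam x hlx x = 0 := Subtype.ext (by simp [hx])
    rw [← hv]
    simp [polyRep, hx, hz', -ι_apply]

end UniversalEnvelopingAlgebra

end EnvelopingAlgebra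

/-! ### Ideals generated by centralizing regular sequences -/

section CentralChain

/-- Left ideals generated by a regular sequence, each element of which is central modulo the
previous ones. -/
inductive CentralChain (R : Type*) [Ring R] : Ideal R → Prop
  | bot : CentralChain R ⊥
  | step {J : Ideal R} (z : R) (hJ : CentralChain R J) (hz : ∀ u, u * z - z * u ∈ J)
      (hreg : ∀ u, z * u ∈ J → u ∈ J) : CentralChain R (J ⊔ Ideal.span {z})

/-- Moving `z` to the right past `b` costs only a commutator, which lies in the two-sided ideal `J`.
-/
theorem Ideal.sup_span_singleton_isTwoSided {R : Type*} [Ring R] {J : Ideal R} (hJ : J.IsTwoSided)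
    {z : R} (hz : ∀ u, u * z - z * u ∈ J) : (J ⊔ Ideal.span {z}).IsTwoSided where
  mul_mem_of_left {a} b ha := by
    obtain ⟨j, hj, y, hy, rfl⟩ := Submodule.mem_sup.1 ha
    obtain ⟨v, rfl⟩ := Ideal.mem_span_singleton'.1 hy
    have h : (j + v * z) * b = (j * b - v * (b * z - z * b)) + (v * b) * z := by noncomm_ring
    rw [h]
    exact Submodule.add_mem_sup (J.sub_mem (hJ.mul_mem_of_left b hj) (J.mul_mem_left v (hz b)))
      (Ideal.mem_span_singleton'.2 ⟨_, rfl⟩)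

theorem CentralChain.isTwoSided {R : Type*} [Ring R] {J : Ideal R} (hJ : CentralChain R J) :
    J.IsTwoSided := by
  induction hJ with
  | bot => infer_instance
  | step z _ hz _ ih => exact Ideal.sup_span_singleton_isTwoSided ih hz

theorem CentralChain.map_ringEquiv {R S : Type*} [Ring R] [Ring S] (e : R ≃+* S) {J : Ideal R}
    (hJ : CentralChain R J) : CentralChain S (J.map e) := by
  induction hJ with
  | bot =>
    rw [Ideal.map_bot]
    exact .bot
  | @step J z _ hz hreg ih =>
    have hmem : ∀ x, e x ∈ J.map e ↔ x ∈ J := fun x => by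
      rw [Ideal.mem_map_of_equiv]
      exact ⟨fun ⟨y, hy, h⟩ => e.injective h ▸ hy, fun h => ⟨x, h, rfl⟩⟩
    rw [Ideal.map_sup, Ideal.map_span, Set.image_singleton]
    refine .step _ ih (fun u => ?_) (fun u hu => ?_)
    · obtain ⟨u, rfl⟩ := e.surjective u
      rw [← map_mul, ← map_mul, ← map_sub, hmem]
      exact hz u
    · obtain ⟨u, rfl⟩ := e.surjective u
      rw [← map_mul, hmem] at hu
      exact (hmem u).2 (hreg u hu)

/-- The ideal generated by the first variables of a polynomial ring. -/
theorem MvPolynomial.centralChain_span_X {k : Type*} [Field k] {σ : Type*} (s : Finset σ) :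
    CentralChain (MvPolynomial σ k) (Ideal.span (MvPolynomial.X '' (s : Set σ))) := by
  classical
  induction s using Finset.induction_on with
  | empty =>
    rw [Finset.coe_empty, Set.image_empty, Ideal.span_empty]
    exact .bot
  | insert i s hi ih =>
    rw [Finset.coe_insert, Set.image_insert_eq, Set.insert_eq, Ideal.span_union, sup_comm]
    refine .step _ ih (fun u => ?_) (fun u hu => ?_)
    · rw [mul_comm, sub_self]
      exact Ideal.zero_mem _
    · rw [MvPolynomial.mem_ideal_span_X_image] at hu ⊢
      intro m hm
      -- The exponent `m` of `u` appears in `X i * u` as `m + eᵢ`. Some variable from `s` divides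
      -- that monomial, and being different from `X i` it already divides the one of `m`.
      obtain ⟨j, hj, hmj⟩ := hu (m + Finsupp.single i 1) (by
        rw [MvPolynomial.mem_support_iff] at hm ⊢
        rwa [add_comm, MvPolynomial.coeff_X_mul])
      refine ⟨j, hj, ?_⟩
      have hij : i ≠ j := fun h => hi (h ▸ hj)
      simpa [hij] using hmj

end CentralChain

/-! ### Ideals of an enveloping algebra induced by ideals of the Lie algebra -/

section EnvelopingAlgebra

attribute [local instance 100] LieRing.ofAssociativeRing

/-- The projection of a Lie algebra to its quotient by an ideal. -/
def LieIdeal.quotientHom {k : Type*} [CommRing k] {L : Type*} [LieRing L] [LieAlgebra k L]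
    (I : LieIdeal k L) : L →ₗ⁅k⁆ L ⧸ I where
  toLinearMap := I.toSubmodule.mkQ
  map_lie' := rfl

/-- The map on the quotient of a Lie algebra by an ideal induced by a map vanishing on the ideal. -/
def LieIdeal.quotientLift {k : Type*} [CommRing k] {L L' : Type*} [LieRing L] [LieAlgebra k L]
    [LieRing L'] [LieAlgebra k L'] (I : LieIdeal k L) (g : L →ₗ⁅k⁆ L') (hg : ∀ x ∈ I, g x = 0) :
    (L ⧸ I) →ₗ⁅k⁆ L' where
  toLinearMap := I.toSubmodule.liftQ (g : L →ₗ[k] L') hg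
  map_lie' := fun {x y} => by
    obtain ⟨x, rfl⟩ := Submodule.Quotient.mk_surjective _ x
    obtain ⟨y, rfl⟩ := Submodule.Quotient.mk_surjective _ y
    exact g.map_lie x y

namespace UniversalEnvelopingAlgebra

variable {k : Type*} [Field k] {L : Type*} [LieRing L] [LieAlgebra k L]

/-- The ideal of `U(L)` generated by an ideal `I` of `L`: the kernel of `U(L) → U(L/I)`. -/
noncomputable def idealOf (I : LieIdeal k L) : Ideal (UniversalEnvelopingAlgebra k L) :=
  RingHom.ker (map I.quotientHom)

instance (I : LieIdeal k L) : (idealOf I).IsTwoSided := by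
  unfold idealOf
  infer_instance

theorem mem_idealOf {I : LieIdeal k L} {u : UniversalEnvelopingAlgebra k L} :
    u ∈ idealOf I ↔ map I.quotientHom u = 0 := Iff.rfl

theorem ι_mem_idealOf {I : LieIdeal k L} {x : L} (hx : x ∈ I) : ι k x ∈ idealOf I := by
  rw [mem_idealOf, map_ι]
  have : I.quotientHom x = 0 := (Submodule.Quotient.mk_eq_zero I.toSubmodule).2 hx
  rw [this, map_zero]

/-- Such an `F` factors through `U(L/I)`. This replaces a description of the kernel by generators.
-/
theorem eq_zero_of_mem_idealOf {I : LieIdeal k L} {A : Type*} [Ring A] [Algebra k A]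
    (F : UniversalEnvelopingAlgebra k L →ₐ[k] A) (hF : ∀ x ∈ I, F (ι k x) = 0)
    {u : UniversalEnvelopingAlgebra k L} (hu : u ∈ idealOf I) : F u = 0 := by
  let g : L →ₗ⁅k⁆ A := (F : UniversalEnvelopingAlgebra k L →ₗ⁅k⁆ A).comp (ι k)
  let f : (L ⧸ I) →ₗ⁅k⁆ A := I.quotientLift g hF
  have h : (lift k f).comp (map I.quotientHom) = F := by
    ext x
    change lift k f (map I.quotientHom (ι k x)) = F (ι k x)
    rw [map_ι, lift_ι_apply]
    rfl
  rw [← h, AlgHom.comp_apply, mem_idealOf.1 hu, map_zero]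

theorem idealOf_le {I : LieIdeal k L} {K : Ideal (UniversalEnvelopingAlgebra k L)}
    (hK : K.IsTwoSided) (h : ∀ x ∈ I, ι k x ∈ K) : idealOf I ≤ K := fun u hu => by
  have := eq_zero_of_mem_idealOf (Ideal.Quotient.mkₐ k K)
    (fun x hx => Ideal.Quotient.eq_zero_iff_mem.2 (h x hx)) hu
  exact Ideal.Quotient.eq_zero_iff_mem.1 this

theorem idealOf_bot : idealOf (⊥ : LieIdeal k L) = ⊥ :=
  eq_bot_iff.2 (idealOf_le inferInstance (fun x hx => by
    rw [(LieSubmodule.mem_bot x).1 hx, map_zero]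
    exact Ideal.zero_mem _))

theorem commute_ι_of_central {z : L} (hz : ∀ x : L, ⁅x, z⁆ = 0)
    (u : UniversalEnvelopingAlgebra k L) : u * ι k z = ι k z * u := by
  induction u using UniversalEnvelopingAlgebra.induction with
  | algebraMap r => exact Algebra.commutes r _
  | ι x => rw [← sub_eq_zero, ι_mul_sub_mul, hz, map_zero]
  | mul a b ha hb => rw [mul_assoc, hb, ← mul_assoc, ha, mul_assoc]
  | add a b ha hb => rw [add_mul, ha, hb, mul_add]

/-- Noetherian induction upwards on an intermediate ideal `b ≤ I`: enlarge `b` by one element of `I`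
central modulo `b`, until `I` is reached. -/
theorem centralChain_idealOf [FiniteDimensional k L] [LieRing.IsNilpotent L] (I : LieIdeal k L) :
    CentralChain (UniversalEnvelopingAlgebra k L) (idealOf I) := by
  suffices h : ∀ b : LieIdeal k L, b ≤ I → CentralChain _ (idealOf b) →
      CentralChain _ (idealOf I) from
    h ⊥ bot_le (by rw [idealOf_bot]; exact .bot)
  intro b
  induction b using WellFoundedGT.induction with
  | ind b ih =>
  intro hb hchain
  obtain rfl | hne := eq_or_ne b I
  · exact hchain
  -- Bracketing `I` repeatedly with `L` ends inside `b` by nilpotency; `z` is taken from the last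
  -- stage not contained in `b`.
  obtain ⟨z, hzI, hzb, hzc⟩ : ∃ z ∈ I, z ∉ b ∧ ∀ x : L, ⁅x, z⁆ ∈ b := by
    classical
    have hex : ∃ j, LieSubmodule.lcs j I ≤ b := by
      obtain ⟨j, hj⟩ := (LieModule.isNilpotent_iff k L L).1 inferInstance
      refine ⟨j, le_trans (le_sup_left (b := LieSubmodule.lcs j (⊤ : LieIdeal k L))) ?_⟩
      rw [← LieSubmodule.lcs_sup, sup_top_eq]
      exact hj.le.trans bot_le
    have h0 : Nat.find hex ≠ 0 := fun h => by
      have := Nat.find_spec hex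
      rw [h] at this
      exact hne (le_antisymm hb this)
    obtain ⟨j, hj⟩ := Nat.exists_eq_succ_of_ne_zero h0
    have h1 : ¬ LieSubmodule.lcs j I ≤ b := Nat.find_min hex (by lia)
    have h2 : LieSubmodule.lcs (j + 1) I ≤ b := by
      rw [← Nat.succ_eq_add_one, ← hj]
      exact Nat.find_spec hex
    obtain ⟨z, hz, hzb⟩ := SetLike.not_le_iff_exists.1 h1
    refine ⟨z, LieSubmodule.lcs_le_self j I hz, hzb, fun x => h2 ?_⟩
    rw [LieSubmodule.lcs_succ]
    exact LieSubmodule.lie_mem_lie (LieSubmodule.mem_top x) hz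
  let b' : LieIdeal k L :=
    { b.toSubmodule ⊔ Submodule.span k {z} with
      lie_mem := fun {x m} hm => by
        obtain ⟨y, hy, t, ht, rfl⟩ := Submodule.mem_sup.1 hm
        obtain ⟨c, rfl⟩ := Submodule.mem_span_singleton.1 ht
        refine Submodule.mem_sup_left ?_
        rw [lie_add, lie_smul]
        exact b.toSubmodule.add_mem (b.lie_mem hy) (b.toSubmodule.smul_mem c (hzc x)) }
  have hbb' : b ≤ b' := fun y hy => Submodule.mem_sup_left (S := b.toSubmodule) hy
  have hzb' : z ∈ b' :=
    Submodule.mem_sup_right (S := b.toSubmodule) (Submodule.mem_span_singleton_self z)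
  have hcomm : ∀ u, u * ι k z - ι k z * u ∈ idealOf b := fun u => by
    rw [mem_idealOf, map_sub, map_mul, map_mul, map_ι, sub_eq_zero]
    refine commute_ι_of_central (fun x => ?_) _
    obtain ⟨x, rfl⟩ := Submodule.Quotient.mk_surjective _ x
    exact (Submodule.Quotient.mk_eq_zero b.toSubmodule).2 (hzc x)
  have heq : idealOf b' = idealOf b ⊔ Ideal.span {ι k z} := by
    refine le_antisymm (idealOf_le (Ideal.sup_span_singleton_isTwoSided inferInstance hcomm) ?_)
      (sup_le (idealOf_le inferInstance fun y hy => ι_mem_idealOf (hbb' hy)) ?_)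
    · intro y hy
      obtain ⟨v, hv, t, ht, rfl⟩ := Submodule.mem_sup.1 (show y ∈ b.toSubmodule ⊔ _ from hy)
      obtain ⟨c, rfl⟩ := Submodule.mem_span_singleton.1 ht
      rw [map_add, map_smul, Algebra.smul_def]
      exact Submodule.add_mem_sup (ι_mem_idealOf hv) (Ideal.mem_span_singleton'.2 ⟨_, rfl⟩)
    · rw [Ideal.span_singleton_le_iff_mem]
      exact ι_mem_idealOf hzb'
  refine ih b' (lt_of_le_of_ne hbb' fun h => hzb (h ▸ hzb')) ?_ ?_
  · intro y hy
    obtain ⟨v, hv, t, ht, rfl⟩ := Submodule.mem_sup.1 (show y ∈ b.toSubmodule ⊔ _ from hy)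
    obtain ⟨c, rfl⟩ := Submodule.mem_span_singleton.1 ht
    exact I.toSubmodule.add_mem (hb hv) (I.toSubmodule.smul_mem c hzI)
  · rw [heq]
    -- Regularity modulo `idealOf b` is tested in `U(L/b)`, where the image of `z` is nonzero and
    -- `L/b` is again nilpotent and finite-dimensional.
    refine .step _ hchain hcomm fun u hu => ?_
    rw [mem_idealOf, map_mul, map_ι] at hu
    have : LieRing.IsNilpotent (L ⧸ b) :=
      Function.Surjective.lieAlgebra_isNilpotent (f := b.quotientHom)
        (Submodule.Quotient.mk_surjective _)
    have : FiniteDimensional k (L ⧸ b) :=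
      inferInstanceAs (FiniteDimensional k (L ⧸ b.toSubmodule))
    exact eq_zero_of_ι_mul_eq_zero
      (fun h => hzb ((Submodule.Quotient.mk_eq_zero b.toSubmodule).1 h)) hu

end UniversalEnvelopingAlgebra

end EnvelopingAlgebra

/-! ### The free nilpotent Lie algebra and its enveloping algebra -/

section FreeNilpotent

attribute [local instance 100] LieRing.ofAssociativeRing

variable (k : Type u) [Field k] (n d : ℕ)

namespace FreeNilpotentLie

/-- The generators of the free nilpotent Lie algebra. -/
noncomputable def gen (i : Fin n) : FreeNilpotentLie k n d :=
  LieSubmodule.Quotient.mk (FreeLieAlgebra.of k i)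

theorem lowerCentralSeries_eq_bot :
    LieModule.lowerCentralSeries k (FreeNilpotentLie k n d) (FreeNilpotentLie k n d) d = ⊥ := by
  let f := LieIdeal.quotientHom (LieModule.lowerCentralSeries k (FreeLieAlgebra k (Fin n))
    (FreeLieAlgebra k (Fin n)) d)
  have hf : Function.Surjective f := Submodule.Quotient.mk_surjective _
  rw [← LieIdeal.lowerCentralSeries_map_eq d hf, LieIdeal.map_eq_bot_iff]
  intro x hx
  exact (Submodule.Quotient.mk_eq_zero _).2 hx

instance : LieRing.IsNilpotent (FreeNilpotentLie k n d) :=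
  (LieModule.isNilpotent_iff k _ _).2 ⟨d, lowerCentralSeries_eq_bot k n d⟩

variable {k n d}

/-- Lifting the generators into `K` and including back is the quotient map from the free Lie
algebra, which is surjective. -/
theorem lieSubalgebra_eq_top {K : LieSubalgebra k (FreeNilpotentLie k n d)}
    (hK : ∀ i, gen k n d i ∈ K) : K = ⊤ := by
  have h : K.incl.comp (FreeLieAlgebra.lift k fun i => (⟨gen k n d i, hK i⟩ : K)) =
      LieIdeal.quotientHom _ := by
    refine FreeLieAlgebra.hom_ext fun i => ?_
    rw [LieHom.comp_apply, FreeLieAlgebra.lift_of_apply]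
    rfl
  rw [eq_top_iff]
  intro y _
  obtain ⟨y, rfl⟩ := Submodule.Quotient.mk_surjective _ y
  have hy := DFunLike.congr_fun h y
  change _ = Submodule.Quotient.mk y at hy
  rw [← hy]
  exact (FreeLieAlgebra.lift k fun i => (⟨gen k n d i, hK i⟩ : K)) y |>.2

variable (k n d) in
/-- The span of the right-normed brackets of `i + 1` generators. -/
noncomputable def brackets : ℕ → Submodule k (FreeNilpotentLie k n d)
  | 0 => Submodule.span k (Set.range (gen k n d))
  | i + 1 => ⨆ j, (brackets i).map (LieAlgebra.ad k _ (gen k n d j) : _ →ₗ[k] _)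

theorem finiteDimensional_brackets (i : ℕ) : FiniteDimensional k (brackets k n d i) := by
  induction i with
  | zero => exact FiniteDimensional.span_of_finite k (Set.finite_range _)
  | succ i ih =>
    rw [brackets]
    infer_instance

theorem brackets_le (i : ℕ) : brackets k n d i ≤
    (LieModule.lowerCentralSeries k (FreeNilpotentLie k n d) (FreeNilpotentLie k n d) i).toSubmodule
    := by
  induction i with
  | zero => exact le_top
  | succ i ih =>
    rw [brackets]
    refine iSup_le fun j => ?_
    rintro _ ⟨y, hy, rfl⟩
    rw [LieModule.lowerCentralSeries_succ]
    exact LieSubmodule.lie_mem_lie (LieSubmodule.mem_top (gen k n d j)) (ih hy)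

theorem lie_mem_brackets (i : ℕ) (j : Fin n) {y : FreeNilpotentLie k n d}
    (hy : y ∈ brackets k n d i) : ⁅gen k n d j, y⁆ ∈ brackets k n d (i + 1) := by
  rw [brackets]
  exact Submodule.mem_iSup_of_mem j ⟨y, hy, rfl⟩

/-- Let `T` be the span of right-normed words with fewer than `d` brackets. The elements whose
adjoint action preserves `T` form a subalgebra by Jacobi; it contains the generators, hence is
everything. So `T` is itself a subalgebra containing the generators. -/
theorem finiteDimensional (hd : 1 ≤ d) : FiniteDimensional k (FreeNilpotentLie k n d) := by
  set T := (Finset.range d).sup (brackets k n d) with hT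
  have hmem : ∀ {i}, i < d → brackets k n d i ≤ T := fun h =>
    Finset.le_sup (f := brackets k n d) (Finset.mem_range.2 h)
  have hgen : ∀ j, ∀ y ∈ T, ⁅gen k n d j, y⁆ ∈ T := by
    intro j
    suffices h : T ≤ T.comap (LieAlgebra.ad k _ (gen k n d j) : _ →ₗ[k] _) from fun y hy => h hy
    conv_lhs => rw [hT]
    refine Finset.sup_le fun i hi y hy => ?_
    have h1 := lie_mem_brackets i j hy
    obtain h | h := Nat.lt_or_ge (i + 1) d
    · exact hmem h h1
    -- The boundary case `i + 1 = d`: the word has `d` brackets and vanishes.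
    · have h2 := brackets_le (i + 1) h1
      obtain rfl : d = i + 1 := le_antisymm h (Finset.mem_range.1 hi)
      rw [lowerCentralSeries_eq_bot] at h2
      have h3 : ⁅gen k n (i + 1) j, y⁆ = 0 := h2
      change ⁅gen k n (i + 1) j, y⁆ ∈ T
      rw [h3]
      exact T.zero_mem
  let N : LieSubalgebra k (FreeNilpotentLie k n d) :=
    { carrier := {x | ∀ y ∈ T, ⁅x, y⁆ ∈ T}
      add_mem' := fun ha hb y hy => by
        rw [add_lie]
        exact T.add_mem (ha y hy) (hb y hy)
      zero_mem' := fun y _ => by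
        rw [zero_lie]
        exact T.zero_mem
      smul_mem' := fun c x hx y hy => by
        rw [smul_lie]
        exact T.smul_mem c (hx y hy)
      lie_mem' := fun {a b} ha hb y hy => by
        rw [lie_lie]
        exact T.sub_mem (ha _ (hb y hy)) (hb _ (ha y hy)) }
  have hN : N = ⊤ := lieSubalgebra_eq_top hgen
  have hstable : ∀ x, ∀ y ∈ T, ⁅x, y⁆ ∈ T := fun x => by
    have : x ∈ N := hN ▸ LieSubalgebra.mem_top x
    exact this
  let K : LieSubalgebra k (FreeNilpotentLie k n d) :=
    { T with lie_mem' := fun {a b} _ hb => hstable a b hb }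
  have hK : K = ⊤ := lieSubalgebra_eq_top fun j =>
    hmem (i := 0) hd (Submodule.subset_span ⟨j, rfl⟩)
  have hT' : T = ⊤ := by
    rw [eq_top_iff]
    intro y _
    have : y ∈ K := hK ▸ LieSubalgebra.mem_top y
    exact this
  have hfin : FiniteDimensional k T := by
    have := fun i => finiteDimensional_brackets (k := k) (n := n) (d := d) i
    exact Submodule.finiteDimensional_finset_sup _ _
  rw [hT'] at hfin
  exact Module.finite_def.2 (Module.Finite.iff_fg.1 hfin)

end FreeNilpotentLie

/-! ### The quotient `U/I` as a polynomial ring, and central chains for both kernels -/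

section Quotient

variable {k n d}

theorem envQuotientMap_surjective : Function.Surjective (envQuotientMap k n d) :=
  RingCon.mk'_surjective _

theorem envQuotientMap_eq_zero_iff {u : EnvNilpotent k n d} :
    envQuotientMap k n d u = 0 ↔ u ∈ commutatorIdeal k n d := by
  rw [TwoSidedIdeal.mem_iff]
  exact RingCon.eq _

theorem adjoin_envGen :
    Algebra.adjoin k (Set.range (envGen k n d)) = ⊤ := by
  set A := Algebra.adjoin k (Set.range (envGen k n d))
  let K : LieSubalgebra k (FreeNilpotentLie k n d) :=
    { carrier := {x | UniversalEnvelopingAlgebra.ι k x ∈ A}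
      add_mem' := fun {a b} ha hb => by
        rw [Set.mem_ofPred_eq, map_add]
        exact A.add_mem ha hb
      zero_mem' := by
        rw [Set.mem_ofPred_eq, map_zero]
        exact A.zero_mem
      smul_mem' := fun c x hx => by
        rw [Set.mem_ofPred_eq, map_smul]
        exact A.smul_mem hx c
      lie_mem' := fun {a b} ha hb => by
        change UniversalEnvelopingAlgebra.ι k ⁅a, b⁆ ∈ A
        rw [← UniversalEnvelopingAlgebra.ι_mul_sub_mul]
        exact A.sub_mem (A.mul_mem ha hb) (A.mul_mem hb ha) }
  have hK : K = ⊤ := FreeNilpotentLie.lieSubalgebra_eq_top fun j =>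
    Algebra.subset_adjoin ⟨j, rfl⟩
  rw [← top_le_iff, ← UniversalEnvelopingAlgebra.adjoin_range_ι, Algebra.adjoin_le_iff]
  rintro _ ⟨x, rfl⟩
  have : x ∈ K := hK ▸ LieSubalgebra.mem_top x
  exact this

theorem adjoin_envQuotientMap_envGen :
    Algebra.adjoin k (Set.range fun i => envQuotientMap k n d (envGen k n d i)) = ⊤ := by
  rw [eq_top_iff]
  intro a _
  obtain ⟨u, rfl⟩ := envQuotientMap_surjective a
  have hu : u ∈ Algebra.adjoin k (Set.range (envGen k n d)) := by
    rw [adjoin_envGen]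
    exact Algebra.mem_top
  have := Subalgebra.mem_map.2 ⟨u, hu, (rfl : envQuotientMap k n d u = _)⟩
  rwa [AlgHom.map_adjoin, ← Set.range_comp] at this

theorem EnvQuotient.mul_comm (a b : EnvQuotient k n d) : a * b = b * a := by
  have hcomm : ∀ a ∈ Set.range fun i => envQuotientMap k n d (envGen k n d i),
      ∀ b ∈ Set.range fun i => envQuotientMap k n d (envGen k n d i), a * b = b * a := by
    rintro _ ⟨i, rfl⟩ _ ⟨j, rfl⟩
    dsimp only
    rw [← sub_eq_zero, ← map_mul, ← map_mul, ← map_sub, envQuotientMap_eq_zero_iff]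
    exact TwoSidedIdeal.subset_span ⟨i, j, rfl⟩
  have htop : ∀ a : EnvQuotient k n d, a ∈ Algebra.adjoin k
      (Set.range fun i => envQuotientMap k n d (envGen k n d i)) := fun a => by
    rw [adjoin_envQuotientMap_envGen]
    exact Algebra.mem_top
  have := Algebra.isMulCommutative_adjoin k hcomm
  exact congrArg Subtype.val (mul_comm' (⟨a, htop a⟩ : Algebra.adjoin k _) ⟨b, htop b⟩)

noncomputable instance : CommRing (EnvQuotient k n d) :=
  { (inferInstance : Ring (EnvQuotient k n d)) with mul_comm := EnvQuotient.mul_comm }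

variable (k n d) in
/-- The algebra map `k[x₁, …, xₙ] → U/I`. -/
noncomputable def polyToEnvQuotient : MvPolynomial (Fin n) k →ₐ[k] EnvQuotient k n d :=
  MvPolynomial.aeval fun i => envQuotientMap k n d (envGen k n d i)

variable (k n d) in
/-- The algebra map `U → k[x₁, …, xₙ]`. -/
noncomputable def envToPoly (hd : 1 ≤ d) : EnvNilpotent k n d →ₐ[k] MvPolynomial (Fin n) k :=
  UniversalEnvelopingAlgebra.lift k
    (LieIdeal.quotientLift _ (FreeLieAlgebra.lift k MvPolynomial.X) fun x hx => by
      -- Brackets die in a commutative target, and `d ≥ 1` puts the `d`-th term of the series inside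
      -- the first.
      have h : LieModule.lowerCentralSeries k (FreeLieAlgebra k (Fin n))
          (FreeLieAlgebra k (Fin n)) 1 ≤
          (FreeLieAlgebra.lift k (MvPolynomial.X : Fin n → MvPolynomial (Fin n) k)).ker := by
        rw [LieModule.lowerCentralSeries_succ, LieSubmodule.lie_le_iff]
        intro a _ b _
        rw [LieHom.mem_ker, LieHom.map_lie, LieRing.of_associative_ring_bracket, mul_comm, sub_self]
      exact LieHom.mem_ker.1 (h (LieModule.antitone_lowerCentralSeries _ _ _ hd hx)))

theorem envToPoly_envGen (hd : 1 ≤ d) (i : Fin n) :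
    envToPoly k n d hd (envGen k n d i) = MvPolynomial.X i := by
  rw [envToPoly, envGen, UniversalEnvelopingAlgebra.lift_ι_apply]
  exact FreeLieAlgebra.lift_of_apply _ i

variable (k n d) in
/-- The algebra map `U/I → k[x₁, …, xₙ]`. -/
noncomputable def envQuotientToPoly (hd : 1 ≤ d) :
    EnvQuotient k n d →ₐ[k] MvPolynomial (Fin n) k :=
  (commutatorIdeal k n d).ringCon.liftₐ (envToPoly k n d hd) (by
    have h : commutatorIdeal k n d ≤ TwoSidedIdeal.ker (envToPoly k n d hd) := by
      refine TwoSidedIdeal.span_le.2 ?_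
      rintro _ ⟨i, j, rfl⟩
      rw [SetLike.mem_coe, TwoSidedIdeal.mem_ker, map_sub, map_mul, map_mul, mul_comm, sub_self]
    intro x y hxy
    have := h ((TwoSidedIdeal.rel_iff _ x y).1 hxy)
    rw [TwoSidedIdeal.mem_ker, map_sub, sub_eq_zero] at this
    exact this)

theorem envQuotientToPoly_envQuotientMap (hd : 1 ≤ d) (u : EnvNilpotent k n d) :
    envQuotientToPoly k n d hd (envQuotientMap k n d u) = envToPoly k n d hd u := rfl

theorem polyToEnvQuotient_X (i : Fin n) :
    polyToEnvQuotient k n d (MvPolynomial.X i) = envQuotientMap k n d (envGen k n d i) :=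
  MvPolynomial.aeval_X _ i

theorem envQuotientToPoly_polyToEnvQuotient (hd : 1 ≤ d) (p : MvPolynomial (Fin n) k) :
    envQuotientToPoly k n d hd (polyToEnvQuotient k n d p) = p := by
  have h : (envQuotientToPoly k n d hd).comp (polyToEnvQuotient k n d) = AlgHom.id k _ := by
    refine MvPolynomial.algHom_ext fun i => ?_
    rw [AlgHom.comp_apply, polyToEnvQuotient_X, envQuotientToPoly_envQuotientMap, envToPoly_envGen]
    rfl
  exact DFunLike.congr_fun h p

theorem polyToEnvQuotient_bijective (hd : 1 ≤ d) :
    Function.Bijective (polyToEnvQuotient k n d) := by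
  refine ⟨Function.LeftInverse.injective (envQuotientToPoly_polyToEnvQuotient hd), fun a => ?_⟩
  have h : (polyToEnvQuotient k n d).range = ⊤ := by
    rw [← top_le_iff, ← adjoin_envQuotientMap_envGen, Algebra.adjoin_le_iff]
    rintro _ ⟨i, rfl⟩
    exact ⟨MvPolynomial.X i, polyToEnvQuotient_X i⟩
  have ha : a ∈ (polyToEnvQuotient k n d).range := h ▸ Algebra.mem_top
  exact ha

variable (k n d) in
/-- The isomorphism `k[x₁, …, xₙ] ≃ U/I`. -/
noncomputable def polyEquivEnvQuotient (hd : 1 ≤ d) :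
    MvPolynomial (Fin n) k ≃ₐ[k] EnvQuotient k n d :=
  AlgEquiv.ofBijective (polyToEnvQuotient k n d) (polyToEnvQuotient_bijective hd)

theorem quotientAugmentation_envQuotientMap (u : EnvNilpotent k n d) :
    quotientAugmentation k n d (envQuotientMap k n d u) = envAugmentation k n d u := rfl

theorem envAugmentation_ι (x : FreeNilpotentLie k n d) :
    envAugmentation k n d (UniversalEnvelopingAlgebra.ι k x) = 0 := by
  rw [envAugmentation, UniversalEnvelopingAlgebra.lift_ι_apply]
  rfl

theorem quotientAugmentation_polyToEnvQuotient (p : MvPolynomial (Fin n) k) :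
    quotientAugmentation k n d (polyToEnvQuotient k n d p) = MvPolynomial.constantCoeff p := by
  have h : (quotientAugmentation k n d).comp (polyToEnvQuotient k n d) =
      MvPolynomial.aeval fun _ => 0 := by
    refine MvPolynomial.algHom_ext fun i => ?_
    rw [AlgHom.comp_apply, polyToEnvQuotient_X, quotientAugmentation_envQuotientMap, envGen,
      envAugmentation_ι, MvPolynomial.aeval_X]
  have hp := DFunLike.congr_fun h p
  rw [AlgHom.comp_apply] at hp
  rw [hp, MvPolynomial.aeval_zero']
  rfl

theorem centralChain_ker_quotientAugmentation (hd : 1 ≤ d) :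
    CentralChain (EnvQuotient k n d) (RingHom.ker (quotientAugmentation k n d)) := by
  have h := (MvPolynomial.centralChain_span_X (k := k) (Finset.univ : Finset (Fin n))).map_ringEquiv
    (polyEquivEnvQuotient k n d hd).toRingEquiv
  convert h
  ext a
  obtain ⟨p, rfl⟩ := (polyEquivEnvQuotient k n d hd).surjective a
  rw [Ideal.mem_map_of_equiv]
  have h1 : p ∈ Ideal.span (MvPolynomial.X '' (↑(Finset.univ : Finset (Fin n)) : Set (Fin n))) ↔
      MvPolynomial.constantCoeff p = 0 := by
    rw [MvPolynomial.mem_ideal_span_X_image, MvPolynomial.constantCoeff_eq]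
    constructor
    · intro hp
      by_contra h0
      obtain ⟨i, _, hi⟩ := hp 0 (MvPolynomial.mem_support_iff.2 h0)
      exact hi rfl
    · intro h0 m hm
      by_contra! hi
      have : m = 0 := Finsupp.ext fun i => hi i (Finset.mem_coe.2 (Finset.mem_univ i))
      rw [this, MvPolynomial.mem_support_iff] at hm
      exact hm h0
  change quotientAugmentation k n d (polyToEnvQuotient k n d p) = 0 ↔ _
  rw [quotientAugmentation_polyToEnvQuotient, ← h1]
  constructor
  · exact fun hp => ⟨p, hp, rfl⟩
  · rintro ⟨q, hq, hqp⟩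
    exact (polyEquivEnvQuotient k n d hd).injective hqp ▸ hq

/-- Each quotient satisfies the relations of the other: `xᵢxⱼ - xⱼxᵢ` comes from an element of
`[L,L]`, and commutativity of `U/I` kills all of `[L,L]`. -/
theorem ker_envQuotientMap : RingHom.ker (envQuotientMap k n d) =
    UniversalEnvelopingAlgebra.idealOf
      (⁅(⊤ : LieIdeal k (FreeNilpotentLie k n d)), (⊤ : LieIdeal k (FreeNilpotentLie k n d))⁆) := by
  apply le_antisymm
  · intro u hu
    let F := UniversalEnvelopingAlgebra.map (LieIdeal.quotientHom
      (⁅(⊤ : LieIdeal k (FreeNilpotentLie k n d)), (⊤ : LieIdeal k (FreeNilpotentLie k n d))⁆))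
    have h : commutatorIdeal k n d ≤ TwoSidedIdeal.ker F := by
      refine TwoSidedIdeal.span_le.2 ?_
      rintro _ ⟨i, j, rfl⟩
      rw [SetLike.mem_coe, TwoSidedIdeal.mem_ker, envGen, envGen,
        UniversalEnvelopingAlgebra.ι_mul_sub_mul]
      exact UniversalEnvelopingAlgebra.ι_mem_idealOf
        (LieSubmodule.lie_mem_lie (LieSubmodule.mem_top _) (LieSubmodule.mem_top _))
    exact (TwoSidedIdeal.mem_ker _).1 (h (envQuotientMap_eq_zero_iff.1 hu))
  · intro u hu
    refine UniversalEnvelopingAlgebra.eq_zero_of_mem_idealOf _ (fun x hx => ?_) hu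
    have h : ⁅(⊤ : LieIdeal k (FreeNilpotentLie k n d)), (⊤ : LieIdeal k (FreeNilpotentLie k n d))⁆
        ≤ (((envQuotientMap k n d : EnvNilpotent k n d →ₗ⁅k⁆ EnvQuotient k n d).comp
          (UniversalEnvelopingAlgebra.ι k)).ker) := by
      rw [LieSubmodule.lie_le_iff]
      intro a _ b _
      rw [LieHom.mem_ker, LieHom.map_lie, LieRing.of_associative_ring_bracket,
        EnvQuotient.mul_comm, sub_self]
    exact LieHom.mem_ker.1 (h hx)

theorem centralChain_ker_envQuotientMap (hd : 1 ≤ d) :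
    CentralChain (EnvNilpotent k n d) (RingHom.ker (envQuotientMap k n d)) := by
  have := FreeNilpotentLie.finiteDimensional (k := k) (n := n) hd
  rw [ker_envQuotientMap]
  exact UniversalEnvelopingAlgebra.centralChain_idealOf _

end Quotient

end FreeNilpotent

/-! ### Reduction of modules modulo an ideal -/

section Reduction

variable {R : Type u} [Ring R]

/-- The functor `M ↦ M / J M`. -/
def reduction (J : Ideal R) : ModuleCat.{u} R ⥤ ModuleCat.{u} R where
  obj M := ModuleCat.of R (M ⧸ (J • ⊤ : Submodule R M))
  map {M N} f := ModuleCat.ofHom (Submodule.mapQ _ _ f.hom (by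
    rw [Submodule.smul_le]
    intro r hr x _
    rw [Submodule.mem_comap, map_smul]
    exact Submodule.smul_mem_smul hr trivial))
  map_id M := by
    ext1
    exact Submodule.linearMap_qext _ rfl
  map_comp f g := by
    ext1
    exact Submodule.linearMap_qext _ rfl

instance (J : Ideal R) : (reduction J).Additive where
  map_add {M N f g} := by
    ext1
    exact Submodule.linearMap_qext _ rfl

theorem reduction_smul_eq_zero {J : Ideal R} {M : ModuleCat.{u} R} {r : R}
    (hr : r ∈ J) (x : (reduction J).obj M) : r • x = 0 := by
  obtain ⟨x, rfl⟩ := Submodule.Quotient.mk_surjective _ x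
  exact (Submodule.Quotient.mk_eq_zero _).2 (Submodule.smul_mem_smul hr trivial)

/-- Multiplication by an element that is central modulo `J`, on `M / J M`. -/
def reductionMul {J : Ideal R} (z : R) (hz : ∀ u, u * z - z * u ∈ J) :
    reduction J ⟶ reduction J where
  app M := ModuleCat.ofHom
    { toFun := fun x => z • x
      map_add' := smul_add z
      map_smul' := fun r x => by
        rw [RingHom.id_apply, ← mul_smul, ← mul_smul, ← sub_eq_zero, ← sub_smul, ← neg_sub,
          neg_smul, neg_eq_zero]
        exact reduction_smul_eq_zero (hz r) x }
  naturality M N f := by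
    ext x
    exact ((reduction J).map f).hom.map_smul z x |>.symm

/-- The projection `M / J M → M / J' M` for `J ≤ J'`. -/
def reductionProj {J J' : Ideal R} (h : J ≤ J') : reduction J ⟶ reduction J' where
  app M := ModuleCat.ofHom (Submodule.factor (Submodule.smul_mono_left h))
  naturality M N f := by
    ext1
    exact Submodule.linearMap_qext _ rfl

/-- For a projective module `M`, regularity of `z` modulo `J` gives regularity on `M / J M`. -/
theorem mem_smul_top_of_smul_mem {J : Ideal R} (hJ : J.IsTwoSided) {z : R}
    (hreg : ∀ u, z * u ∈ J → u ∈ J) {M : Type u} [AddCommGroup M] [Module R M]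
    [Module.Projective R M] {x : M} (hx : z • x ∈ (J • ⊤ : Submodule R M)) :
    x ∈ (J • ⊤ : Submodule R M) := by
  -- A splitting `s` of a free cover gives coordinates. Since `J` is two-sided, elements of `JM`
  -- have coordinates in `J`, so regularity is applied coordinatewise.
  obtain ⟨s, hs⟩ := Module.projective_lifting_property (Finsupp.linearCombination R (id : M → M))
    LinearMap.id (fun m => ⟨Finsupp.single m 1, by simp⟩)
  have key : ∀ y ∈ (J • ⊤ : Submodule R M), ∀ i, s y i ∈ J := by
    intro y hy
    refine Submodule.smul_induction_on hy (fun r hr m _ i => ?_) (fun a b ha hb i => ?_)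
    · rw [map_smul, Finsupp.smul_apply, smul_eq_mul]
      exact hJ.mul_mem_of_left _ hr
    · rw [map_add, Finsupp.add_apply]
      exact J.add_mem (ha i) (hb i)
  have hsx : ∀ i, s x i ∈ J := fun i => hreg _ (by
    have := key _ hx i
    rwa [map_smul, Finsupp.smul_apply, smul_eq_mul] at this)
  have h : x = (s x).sum fun m r => r • m := by
    conv_lhs => rw [← LinearMap.id_apply (R := R) x, ← hs]
    rfl
  rw [h]
  exact Submodule.sum_mem _ fun i _ => Submodule.smul_mem_smul (hsx i) trivial

/-- The short complex `M / J M → M / J M → M / J' M` where `J' = J + R z`. -/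
def reductionShortComplex {J : Ideal R} (z : R)
    (hz : ∀ u, u * z - z * u ∈ J) (M : ModuleCat.{u} R) : ShortComplex (ModuleCat.{u} R) where
  f := (reductionMul z hz).app M
  g := (reductionProj (le_sup_left : J ≤ J ⊔ Ideal.span {z})).app M
  zero := by
    ext x
    obtain ⟨x, rfl⟩ := Submodule.Quotient.mk_surjective _ x
    exact (Submodule.Quotient.mk_eq_zero _).2 (Submodule.smul_mem_smul
      (Submodule.mem_sup_right (Ideal.mem_span_singleton_self z)) trivial)

/-- Exactness in the middle holds because `(j + v z) m ≡ z (v m)` modulo `JM`. Regularity and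
projectivity enter only in injectivity on the left. -/
theorem reductionShortComplex_shortExact {J : Ideal R} (hJ : J.IsTwoSided) {z : R}
    (hz : ∀ u, u * z - z * u ∈ J) (hreg : ∀ u, z * u ∈ J → u ∈ J) (M : ModuleCat.{u} R)
    [Projective M] : (reductionShortComplex z hz M).ShortExact where
  exact := by
    rw [ShortComplex.moduleCat_exact_iff]
    intro x hx
    obtain ⟨x, rfl⟩ := Submodule.Quotient.mk_surjective _ x
    have hx' : x ∈ ((J ⊔ Ideal.span {z}) • ⊤ : Submodule R M) :=
      (Submodule.Quotient.mk_eq_zero _).1 hx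
    refine Submodule.smul_induction_on (p := fun x =>
      ∃ y, (reductionShortComplex z hz M).f y = Submodule.Quotient.mk x) hx'
      (fun r hr m _ => ?_) ?_
    · obtain ⟨j, hj, y, hy, rfl⟩ := Submodule.mem_sup.1 hr
      obtain ⟨v, rfl⟩ := Ideal.mem_span_singleton'.1 hy
      refine ⟨Submodule.Quotient.mk (v • m), ?_⟩
      refine (Submodule.Quotient.eq _).2 ?_
      have h : z • v • m - (j + v * z) • m = (-(v * z - z * v) - j) • m := by
        simp only [sub_smul, neg_smul, add_smul, mul_smul]
        abel
      rw [h]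
      exact Submodule.smul_mem_smul (J.sub_mem (J.neg_mem (hz v)) hj) trivial
    · rintro a b ⟨y, hy⟩ ⟨y', hy'⟩
      exact ⟨y + y', by rw [map_add, hy, hy']; rfl⟩
  mono_f := by
    have : Module.Projective R M := (IsProjective.iff_projective (R := R) M).2 inferInstance
    rw [ModuleCat.mono_iff_injective, injective_iff_map_eq_zero]
    intro x hx
    obtain ⟨x, rfl⟩ := Submodule.Quotient.mk_surjective _ x
    exact (Submodule.Quotient.mk_eq_zero _).2
      (mem_smul_top_of_smul_mem hJ hreg ((Submodule.Quotient.mk_eq_zero _).1 hx))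
  epi_g := by
    rw [ModuleCat.epi_iff_surjective]
    intro x
    obtain ⟨x, rfl⟩ := Submodule.Quotient.mk_surjective _ x
    exact ⟨Submodule.Quotient.mk x, rfl⟩

/-- The functor `M ↦ M / 0 M` is the identity. -/
noncomputable def reductionBot : reduction (⊥ : Ideal R) ≅ 𝟭 (ModuleCat.{u} R) :=
  NatIso.ofComponents
    (fun M => (Submodule.quotEquivOfEqBot _ (by rw [Submodule.bot_smul])).toModuleIso)
    (fun {M N} f => by
      ext1
      exact Submodule.linearMap_qext _ rfl)

/-- The complex `K / J K`. -/
noncomputable abbrev reductionComplex (J : Ideal R) (K : CochainComplex (ModuleCat.{u} R) ℤ) :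
    CochainComplex (ModuleCat.{u} R) ℤ :=
  ((reduction J).mapHomologicalComplex _).obj K

/-- A class of complexes which contains `K` and is closed under cokernels of monomorphisms
contains `K / J K`. -/
theorem CentralChain.reductionComplex_mem {J : Ideal R} (hJ : CentralChain R J)
    (K : CochainComplex (ModuleCat.{u} R) ℤ) [∀ i, Projective (K.X i)]
    (C : ObjectProperty (CochainComplex (ModuleCat.{u} R) ℤ)) [C.IsClosedUnderIsomorphisms]
    (hK : C K) (hC : ∀ S : ShortComplex (CochainComplex (ModuleCat.{u} R) ℤ), S.ShortExact →
      C S.X₁ → C S.X₂ → C S.X₃) : C (reductionComplex J K) := by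
  induction hJ with
  | bot =>
    refine C.prop_of_iso (Iso.symm ?_) hK
    exact (NatIso.mapHomologicalComplex reductionBot _).app K ≪≫
      (Functor.mapHomologicalComplexIdIso _ _).app K
  | @step J z hJ hz hreg ih =>
    have h2 := hJ.isTwoSided
    let S : ShortComplex (CochainComplex (ModuleCat.{u} R) ℤ) :=
      { f := (NatTrans.mapHomologicalComplex (reductionMul z hz) _).app K
        g := (NatTrans.mapHomologicalComplex
          (reductionProj (le_sup_left : J ≤ J ⊔ Ideal.span {z})) _).app K
        zero := by
          ext1 i
          exact (reductionShortComplex z hz (K.X i)).zero }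
    -- Both outer inputs are `K/JK`, so only closure under cokernels is needed. This lets the same
    -- induction serve cohomological finiteness and membership in a triangulated subcategory.
    refine hC S ?_ ih ih
    refine HomologicalComplex.shortExact_of_degreewise_shortExact S fun i => ?_
    exact reductionShortComplex_shortExact h2 hz hreg (K.X i)

end Reduction

/-! ### Properties of the extension of scalars -/

section ExtendScalars

variable {A B : Type u} [Ring A] [Ring B] (f : A →+* B)

namespace BalancedTensor

theorem mk_mul_tmul {M : Type u} [AddCommGroup M] [Module A M] (b : B) (a : A) (m : M) :
    (Submodule.Quotient.mk ((b * f a) ⊗ₜ[ℤ] m) : BalancedTensor f M) =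
      Submodule.Quotient.mk (b ⊗ₜ[ℤ] (a • m)) :=
  (Submodule.Quotient.eq _).2 (Submodule.subset_span ⟨b, a, m, rfl⟩)

/-- The map `B ⊗_A M → N` induced by an `A`-semilinear map `M → N`. -/
noncomputable def lift {M N : Type u} [AddCommGroup M] [Module A M] [AddCommGroup N] [Module B N]
    (g : M →ₛₗ[f] N) : BalancedTensor f M →ₗ[B] N :=
  Submodule.liftQ _
    (TensorProduct.AlgebraTensorModule.lift
      (LinearMap.toSpanSingleton B (M →ₗ[ℤ] N) g.toAddMonoidHom.toIntLinearMap)) (by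
      rw [balancedRel, Submodule.span_le]
      rintro _ ⟨b, a, m, rfl⟩
      simp [mul_smul])

@[simp]
theorem lift_mk_tmul {M N : Type u} [AddCommGroup M] [Module A M] [AddCommGroup N] [Module B N]
    (g : M →ₛₗ[f] N) (b : B) (m : M) :
    lift f g (Submodule.Quotient.mk (b ⊗ₜ[ℤ] m)) = b • g m := rfl

/-- The map `M → B ⊗_A M`, `m ↦ 1 ⊗ m`. -/
def unit (M : Type u) [AddCommGroup M] [Module A M] : M →ₛₗ[f] BalancedTensor f M where
  toFun m := Submodule.Quotient.mk (1 ⊗ₜ[ℤ] m)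
  map_add' a b := congrArg (balancedRel f M).mkQ (TensorProduct.tmul_add 1 a b)
  map_smul' a m := by
    rw [← mk_mul_tmul, one_mul, ← Submodule.Quotient.mk_smul, TensorProduct.smul_tmul', smul_eq_mul,
      mul_one]

theorem unit_apply {M : Type u} [AddCommGroup M] [Module A M] (m : M) :
    unit f M m = Submodule.Quotient.mk (1 ⊗ₜ[ℤ] m) := rfl

theorem smul_unit {M : Type u} [AddCommGroup M] [Module A M] (b : B) (m : M) :
    b • unit f M m = Submodule.Quotient.mk (b ⊗ₜ[ℤ] m) := by
  rw [unit_apply, ← Submodule.Quotient.mk_smul, TensorProduct.smul_tmul', smul_eq_mul, mul_one]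

end BalancedTensor

/-- Extension of scalars is left adjoint to restriction, which preserves surjections: lift the unit
`M → B ⊗_A M` over `A`, then extend `B`-linearly. -/
theorem baseChangeFunctor_obj_projective (M : ModuleCat.{u} A) [Projective M] :
    Projective ((baseChangeFunctor f).obj M) := by
  have : Module.Projective A M := (IsProjective.iff_projective (R := A) M).2 inferInstance
  refine (IsProjective.iff_projective (R := B) (BalancedTensor f M)).1 ?_
  refine Module.Projective.of_lifting_property'' fun g hg => ?_
  let _ : Module A (BalancedTensor f M →₀ B) := Module.compHom _ f
  let _ : Module A (BalancedTensor f M) := Module.compHom _ f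
  let gA : (BalancedTensor f M →₀ B) →ₗ[A] BalancedTensor f M :=
    { toFun := g
      map_add' := map_add g
      map_smul' := fun a x => g.map_smul (f a) x }
  let uA : M →ₗ[A] BalancedTensor f M :=
    { toFun := BalancedTensor.unit f M
      map_add' := map_add _
      map_smul' := fun a x => (BalancedTensor.unit f M).map_smulₛₗ a x }
  obtain ⟨h, hh⟩ := Module.projective_lifting_property gA uA hg
  let h' : M →ₛₗ[f] (BalancedTensor f M →₀ B) :=
    { toFun := h
      map_add' := map_add h
      map_smul' := fun a x => h.map_smul a x }
  refine ⟨BalancedTensor.lift f h', BalancedTensor.hom_ext f fun b m => ?_⟩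
  have h1 : g (h m) = BalancedTensor.unit f M m := DFunLike.congr_fun hh m
  rw [LinearMap.comp_apply, BalancedTensor.lift_mk_tmul, map_smul, LinearMap.id_apply,
    ← BalancedTensor.smul_unit, ← h1]
  rfl

variable {f}

theorem unit_surjective (hf : Function.Surjective f) (M : Type u) [AddCommGroup M] [Module A M] :
    Function.Surjective (BalancedTensor.unit f M) := by
  intro x
  obtain ⟨x, rfl⟩ := Submodule.Quotient.mk_surjective _ x
  induction x with
  | zero => exact ⟨0, map_zero _⟩
  | tmul b m =>
    obtain ⟨a, rfl⟩ := hf b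
    exact ⟨a • m, by rw [BalancedTensor.unit_apply, ← BalancedTensor.mk_mul_tmul, one_mul]⟩
  | add x y hx hy =>
    obtain ⟨m, hm⟩ := hx
    obtain ⟨m', hm'⟩ := hy
    exact ⟨m + m', by rw [map_add, hm, hm']; rfl⟩

/-- For the direct implication, `M/(ker f)M` is a `B`-module and the projection from `M` is
semilinear, so it factors through `B ⊗_A M`. -/
theorem unit_eq_zero_iff (hf : Function.Surjective f) (M : Type u) [AddCommGroup M] [Module A M]
    (m : M) : BalancedTensor.unit f M m = 0 ↔ m ∈ (RingHom.ker f • ⊤ : Submodule A M) := by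
  constructor
  · intro h
    set N := M ⧸ (RingHom.ker f • ⊤ : Submodule A M)
    have hN : ∀ a ∈ RingHom.ker f, ∀ x : N, a • x = 0 := fun a ha x => by
      obtain ⟨x, rfl⟩ := Submodule.Quotient.mk_surjective _ x
      exact (Submodule.Quotient.mk_eq_zero _).2 (Submodule.smul_mem_smul ha trivial)
    have hN' : ∀ a a', f a = f a' → ∀ x : N, a • x = a' • x := fun a a' h x => by
      rw [← sub_eq_zero, ← sub_smul]
      exact hN _ (by rw [RingHom.mem_ker, map_sub, h, sub_self]) x
    -- A set-theoretic section suffices: by `hN'` the action of a lift depends only on its image in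
    -- `B`.
    let σ := Function.surjInv hf
    have hσ : ∀ b, f (σ b) = b := Function.surjInv_eq hf
    let _ : Module B N :=
      { smul := fun b x => σ b • x
        one_smul := fun x => (hN' _ 1 (by rw [hσ, map_one]) x).trans (one_smul A x)
        mul_smul := fun b c x =>
          (hN' _ (σ b * σ c) (by rw [map_mul, hσ, hσ, hσ]) x).trans (mul_smul _ _ x)
        smul_zero := fun b => smul_zero (σ b)
        smul_add := fun b => smul_add (σ b)
        add_smul := fun b c x =>
          (hN' _ (σ b + σ c) (by rw [map_add, hσ, hσ, hσ]) x).trans (add_smul _ _ x)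
        zero_smul := fun x => (hN' _ 0 (by rw [hσ, map_zero]) x).trans (zero_smul A x) }
    let g : M →ₛₗ[f] N :=
      { toFun := Submodule.Quotient.mk
        map_add' := fun _ _ => rfl
        map_smul' := fun a x => (hN' _ _ (hσ (f a)) (Submodule.Quotient.mk x)).symm }
    have h1 := congrArg (BalancedTensor.lift f g) h
    rw [BalancedTensor.unit_apply, BalancedTensor.lift_mk_tmul, one_smul, map_zero] at h1
    exact (Submodule.Quotient.mk_eq_zero _).1 h1
  · intro hm
    refine Submodule.smul_induction_on hm (fun r hr m _ => ?_) (fun x y hx hy => ?_)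
    · rw [LinearMap.map_smulₛₗ, RingHom.mem_ker.1 hr, zero_smul]
    · rw [map_add, hx, hy, add_zero]

/-- For a surjective ring homomorphism `f : A → B`, the `A`-module `B ⊗_A M` is `M / (ker f) M`. -/
noncomputable def reductionIsoBaseChange (hf : Function.Surjective f) :
    reduction (RingHom.ker f) ≅ baseChangeFunctor f ⋙ ModuleCat.restrictScalars f :=
  NatIso.ofComponents
    (fun M =>
      let g : M →ₗ[A] (ModuleCat.restrictScalars f).obj (ModuleCat.of B (BalancedTensor f M)) :=
        { toFun := BalancedTensor.unit f M
          map_add' := map_add _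
          map_smul' := fun a m => LinearMap.map_smulₛₗ (BalancedTensor.unit f M) a m }
      (LinearEquiv.ofBijective (Submodule.liftQ _ g fun m hm => (unit_eq_zero_iff hf M m).2 hm) (by
        constructor
        · rw [injective_iff_map_eq_zero]
          intro x hx
          obtain ⟨x, rfl⟩ := Submodule.Quotient.mk_surjective _ x
          exact (Submodule.Quotient.mk_eq_zero _).2 ((unit_eq_zero_iff hf M x).1 hx)
        · intro y
          obtain ⟨x, rfl⟩ := unit_surjective hf M y
          exact ⟨Submodule.Quotient.mk x, rfl⟩)).toModuleIso)
    (fun {M N} g => by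
      ext1
      exact Submodule.linearMap_qext _ rfl)

end ExtendScalars

/-! ### Dévissage in derived categories -/

section Devissage

open DerivedCategory Limits

variable {C : Type*} [Category* C] [Abelian C] [HasDerivedCategory.{w} C]

theorem DerivedCategory.prop_singleFunctor_obj (P : ObjectProperty (DerivedCategory C))
    [P.IsStableUnderShift ℤ] [P.IsClosedUnderIsomorphisms] (n : ℤ) (X : C)
    (hX : P ((singleFunctor C 0).obj X)) : P ((singleFunctor C n).obj X) :=
  P.prop_of_iso (((singleFunctors C).shiftIso (-n) n 0 (by lia)).app X) (P.le_shift (-n) _ hX)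

/-- A complex with bounded cohomology belongs to every triangulated subcategory which contains its
cohomology objects. -/
theorem DerivedCategory.prop_Q_obj_of_homology (P : ObjectProperty (DerivedCategory C))
    [P.IsTriangulated] [P.IsClosedUnderIsomorphisms] (a : ℤ) (m : ℕ) (K : CochainComplex C ℤ)
    (hK : ∀ i, i < a ∨ a + m ≤ i → IsZero (K.homology i))
    (hP : ∀ i, P ((singleFunctor C 0).obj (K.homology i))) : P (Q.obj K) := by
  induction m generalizing K with
  | zero =>
    have h1 : (Q.obj K).IsLE (a - 1) := by
      rw [isLE_Q_obj_iff, CochainComplex.isLE_iff]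
      intro i hi
      rw [HomologicalComplex.exactAt_iff_isZero_homology]
      exact hK i (by lia)
    have h2 : (Q.obj K).IsGE a := by
      rw [isGE_Q_obj_iff, CochainComplex.isGE_iff]
      intro i hi
      rw [HomologicalComplex.exactAt_iff_isZero_homology]
      exact hK i (by lia)
    exact P.prop_of_isZero (TStructure.t.isZero (Q.obj K) (a - 1) a (by lia))
  | succ m ih =>
    -- The cohomology sits in degrees `a, …, a + m`. The top degree is split off: the lower
    -- truncation has `m` degrees left, and the upper one is a single shifted module.
    have hLE : P (Q.obj (K.truncLE (a + m - 1))) := by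
      have hi : ∀ i, i ≤ a + m - 1 →
          Nonempty ((K.truncLE (a + m - 1)).homology i ≅ K.homology i) := fun i hi => by
        have := K.quasiIsoAt_ιTruncLE (a + m - 1) i hi
        exact ⟨isoOfQuasiIsoAt (K.ιTruncLE (a + m - 1)) i⟩
      have hi' : ∀ i, a + m - 1 < i → IsZero ((K.truncLE (a + m - 1)).homology i) := fun i hi =>
        CochainComplex.isZero_of_isLE _ (a + m - 1) i hi
      refine ih _ (fun i hia => ?_) fun i => ?_
      · by_cases h : i ≤ a + m - 1
        · exact (hK i (by lia)).of_iso (hi i h).some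
        · exact hi' i (by lia)
      · by_cases h : i ≤ a + m - 1
        · exact P.prop_of_iso ((singleFunctor C 0).mapIso (hi i h).some.symm) (hP i)
        · exact P.prop_of_isZero ((singleFunctor C 0).map_isZero (hi' i (by lia)))
    have hGE : P (Q.obj (K.truncGE (a + m))) := by
      have h1 : (Q.obj (K.truncGE (a + m))).IsLE (a + m) := by
        rw [isLE_Q_obj_iff, CochainComplex.isLE_iff]
        intro i hi
        rw [HomologicalComplex.exactAt_iff_isZero_homology]
        have := K.quasiIsoAt_πTruncGE (a + m) i hi.le
        refine (hK i (Or.inr ?_)).of_iso (isoOfQuasiIsoAt (K.πTruncGE (a + m)) i).symm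
        push_cast
        lia
      obtain ⟨Y, ⟨e⟩⟩ := exists_iso_singleFunctor_obj_of_isGE_of_isLE
        (Q.obj (K.truncGE (a + m))) (a + m)
      have e' : Y ≅ K.homology (a + m) :=
        ((singleFunctorCompHomologyFunctorIso C (a + m)).app Y).symm ≪≫
          (homologyFunctor C (a + m)).mapIso e.symm ≪≫ (homologyFunctorFactors C (a + m)).app _ ≪≫
          (isoOfQuasiIsoAt (K.πTruncGE (a + m)) (a + m)).symm
      refine P.prop_of_iso e.symm (prop_singleFunctor_obj P _ _ ?_)
      exact P.prop_of_iso ((singleFunctor C 0).mapIso e'.symm) (hP _)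
    refine P.ext_of_isTriangulatedClosed₂ _
      (triangleOfSES_distinguished (K.shortComplexTruncLE_shortExact (a + m - 1))) hLE ?_
    exact P.prop_of_iso
      (asIso (Q.map (K.shortComplexTruncLEX₃ToTruncGE (a + m - 1) (a + m) (by lia)))).symm hGE

end Devissage

/-! ### Eilenberg swindle: retracts in localizing subcategories -/

section Swindle

open Limits Pretriangulated

variable {C : Type*} [Category* C] [HasZeroObject C] [HasShift C ℤ] [Preadditive C]
  [∀ (n : ℤ), (shiftFunctor C n).Additive] [Pretriangulated C]

/-- Any object isomorphic to `X` is a coproduct of the one-member family `X`. -/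
theorem IsLocalizingSubcategory.isClosedUnderIsomorphisms {P : ObjectProperty C}
    (hP : IsLocalizingSubcategory.{u} P) : P.IsClosedUnderIsomorphisms where
  of_iso {X Y} e hX := by
    have := hP.closedUnderCoproducts PUnit
    exact P.prop_of_isColimit (Cofan.IsColimit.mk
      (Cofan.mk Y fun _ => e.hom : Cofan fun _ : PUnit.{u + 1} => X) (fun t => e.inv ≫ t.inj PUnit.unit) (fun t j => by simp)
      (fun t m hm => by simp [← hm])) fun _ => hX

/-- A localizing subcategory contains the retracts of an object `Z` of which the countable
coproduct exists. -/
theorem IsLocalizingSubcategory.prop_of_retract {P : ObjectProperty C}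
    (hP : IsLocalizingSubcategory.{u} P) {Y Z : C} (r : Retract Y Z) (hZ : P Z)
    (c : Cofan fun _ : ULift.{u} ℕ => Z) (hc : IsColimit c) : P Y := by
  have := hP.isTriangulated
  have := hP.closedUnderCoproducts (ULift.{u} ℕ)
  have := hP.isClosedUnderIsomorphisms
  have hW : P c.pt := P.prop_of_isColimit hc fun _ => hZ
  set e : Z ⟶ Z := r.r ≫ r.i with he
  have hee : e ≫ e = e := by simp [he]
  have hie : r.i ≫ e = r.i := by simp [he]
  have her : e ≫ r.r = r.r := by simp [he]
  have hri : r.r ≫ r.i = e := rfl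
  let i (j : ℕ) : Z ⟶ c.pt := c.inj ⟨j⟩
  -- With `W` the countable coproduct, these maps give `W ≅ W ⊞ Y`: `φ` moves the `Y`-part of each
  -- copy one index up and fixes the complementary part, `ψ` moves it back down and drops the one at
  -- index `0`, and `π` reads off that dropped part. The triangle `W → W ⊞ Y → Y` then yields `Y`.
  let φ : c.pt ⟶ c.pt := Cofan.IsColimit.desc hc fun j => (𝟙 Z - e) ≫ i j.down +
    e ≫ i (j.down + 1)
  let ψ : c.pt ⟶ c.pt := Cofan.IsColimit.desc hc fun j => (𝟙 Z - e) ≫ i j.down +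
    Nat.casesOn j.down 0 fun l => e ≫ i l
  let π : c.pt ⟶ Y := Cofan.IsColimit.desc hc fun j => Nat.casesOn j.down r.r fun _ => 0
  have hφ (j : ℕ) : i j ≫ φ = (𝟙 Z - e) ≫ i j + e ≫ i (j + 1) := Cofan.IsColimit.fac hc _ ⟨j⟩
  have hψ₀ : i 0 ≫ ψ = (𝟙 Z - e) ≫ i 0 + 0 := Cofan.IsColimit.fac hc _ ⟨0⟩
  have hψ (j : ℕ) : i (j + 1) ≫ ψ = (𝟙 Z - e) ≫ i (j + 1) + e ≫ i j :=
    Cofan.IsColimit.fac hc _ ⟨j + 1⟩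
  have hπ₀ : i 0 ≫ π = r.r := Cofan.IsColimit.fac hc _ ⟨0⟩
  have hπ (j : ℕ) : i (j + 1) ≫ π = 0 := Cofan.IsColimit.fac hc _ ⟨j + 1⟩
  have hext {A : C} {f g : c.pt ⟶ A} (h₀ : i 0 ≫ f = i 0 ≫ g)
      (h : ∀ j, i (j + 1) ≫ f = i (j + 1) ≫ g) : f = g := by
    refine Cofan.IsColimit.hom_ext hc _ _ ?_
    rintro ⟨_ | j⟩
    · exact h₀
    · exact h j
  have hee' {A : C} (f : Z ⟶ A) : e ≫ e ≫ f = e ≫ f := by rw [← Category.assoc, hee]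
  have hie' {A : C} (f : Z ⟶ A) : r.i ≫ e ≫ f = r.i ≫ f := by rw [← Category.assoc, hie]
  have hri' {A : C} (f : Z ⟶ A) : r.r ≫ r.i ≫ f = e ≫ f := by rw [← Category.assoc, hri]
  have h1 : φ ≫ ψ = 𝟙 _ := by
    refine hext ?_ fun j => ?_
    · simp only [reassoc_of% hφ, Preadditive.add_comp, Preadditive.sub_comp, Category.assoc,
        Category.id_comp, Category.comp_id, hψ₀, hψ, Preadditive.comp_add, Preadditive.comp_sub, hee',
        Limits.comp_zero]
      abel
    · simp only [reassoc_of% hφ, Preadditive.add_comp, Preadditive.sub_comp, Category.assoc,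
        Category.id_comp, Category.comp_id, hψ, Preadditive.comp_add, Preadditive.comp_sub, hee']
      abel
  have h2 : φ ≫ π = 0 := by
    refine hext ?_ fun j => ?_
    · simp only [reassoc_of% hφ, Preadditive.add_comp, Preadditive.sub_comp, Category.assoc,
        Category.id_comp, hπ₀, hπ, her, Limits.comp_zero]
      abel
    · simp only [reassoc_of% hφ, Preadditive.add_comp, Preadditive.sub_comp, Category.assoc,
        Category.id_comp, hπ, Limits.comp_zero]
      abel
  have h3 : (r.i ≫ i 0) ≫ ψ = 0 := by
    simp only [Category.assoc, hψ₀, Preadditive.comp_add, Preadditive.comp_sub,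
      Preadditive.sub_comp, Category.id_comp, hie', Limits.comp_zero]
    abel
  have h4 : (r.i ≫ i 0) ≫ π = 𝟙 _ := by
    rw [Category.assoc, hπ₀, r.retract]
  have h5 : ψ ≫ φ + π ≫ r.i ≫ i 0 = 𝟙 _ := by
    refine hext ?_ fun j => ?_
    · simp only [reassoc_of% hψ₀, reassoc_of% hπ₀, Preadditive.add_comp, Preadditive.sub_comp,
        Category.assoc, Category.id_comp, Category.comp_id, hφ, Preadditive.comp_add,
        Preadditive.comp_sub, hee', hri', Limits.zero_comp]
      abel
    · simp only [reassoc_of% hψ, reassoc_of% hπ, Preadditive.add_comp, Preadditive.sub_comp,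
        Category.assoc, Category.id_comp, Category.comp_id, hφ, Preadditive.comp_add,
        Preadditive.comp_sub, hee', Limits.zero_comp]
      abel
  let E : c.pt ≅ c.pt ⊞ Y :=
    { hom := biprod.lift ψ π
      inv := biprod.desc φ (r.i ≫ i 0)
      hom_inv_id := by rw [biprod.lift_desc, h5]
      inv_hom_id := by
        apply biprod.hom_ext <;> apply biprod.hom_ext' <;> simp [h1, h2, ← h3, ← h4] }
  exact P.ext_of_isTriangulatedClosed₃ _ (binaryBiproductTriangle_distinguished c.pt Y) hW
    (P.prop_of_iso E hW)

end Swindle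

/-! ### Complexes of projective objects and coproducts in derived categories -/

section BoundedAboveProjective

open DerivedCategory Limits

variable {C : Type*} [Category.{u} C] [Abelian C]

/-- Homotopies to zero on the summands of a coproduct of complexes, if they exist, can be
assembled. -/
theorem CochainComplex.nonempty_homotopy_zero_of_isColimit {J : Type*} {K : J → CochainComplex C ℤ}
    [HasColimitsOfShape (Discrete J) C] {c : Cofan K} (hc : IsColimit c)
    {L : CochainComplex C ℤ} (f : c.pt ⟶ L) (h : ∀ j, Nonempty (Homotopy (c.inj j ≫ f) 0)) :
    Nonempty (Homotopy f 0) := by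
  let hcn (n : ℤ) : IsColimit (Cofan.mk (c.pt.X n) fun j => (c.inj j).f n) :=
    isColimitCofanMkObjOfIsColimit (HomologicalComplex.eval C (ComplexShape.up ℤ) n) _ c.inj
      (hc.ofIsoColimit (Cofan.ext (Iso.refl _)))
  let η (i j : ℤ) : c.pt.X i ⟶ L.X j := Cofan.IsColimit.desc (hcn i) fun l => (h l).some.hom i j
  have hη (l : J) (i j : ℤ) : (c.inj l).f i ≫ η i j = (h l).some.hom i j :=
    Cofan.IsColimit.fac (hcn i) _ l
  refine ⟨{ hom := η, zero := fun i j hij => ?_, comm := fun i => ?_ }⟩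
  · refine Cofan.IsColimit.hom_ext (hcn i) _ _ fun l => ?_
    exact (hη l i j).trans (((h l).some.zero i j hij).trans comp_zero.symm)
  · refine Cofan.IsColimit.hom_ext (hcn i) _ _ fun l => ?_
    have h1 := (h l).some.comm i
    have h2 : (fun i j => (c.inj l).f i ≫ η i j) = (h l).some.hom := by
      ext i j
      exact hη l i j
    change (c.inj l).f i ≫ f.f i = (c.inj l).f i ≫ _
    rw [Preadditive.comp_add, Preadditive.comp_add, ← dNext_comp_left, ← prevD_comp_left, h2]
    simpa using h1

variable [HasDerivedCategory.{w} C]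

/-- Out of a K-projective complex, morphisms in the derived category are homotopy classes of chain
maps. -/
theorem CochainComplex.IsKProjective.exists_Q_map_eq {K : CochainComplex C ℤ} [K.IsKProjective]
    {L : CochainComplex C ℤ} (g : Q.obj K ⟶ Q.obj L) : ∃ f : K ⟶ L, Q.map f = g := by
  obtain ⟨f', hf'⟩ := (Qh_map_bijective K ((HomotopyCategory.quotient _ _).obj L)).surjective
    ((quotientCompQhIso C).hom.app K ≫ g ≫ (quotientCompQhIso C).inv.app L)
  obtain ⟨f, rfl⟩ := (HomotopyCategory.quotient _ _).map_surjective f'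
  refine ⟨f, ?_⟩
  rw [← cancel_epi ((quotientCompQhIso C).hom.app K), ← quotientCompQhIso_hom_naturality, hf']
  simp

theorem CochainComplex.IsKProjective.nonempty_homotopy_of_Q_map_eq_zero {K : CochainComplex C ℤ}
    [K.IsKProjective] {L : CochainComplex C ℤ} (f : K ⟶ L) (hf : Q.map f = 0) :
    Nonempty (Homotopy f 0) := by
  refine ⟨HomotopyCategory.homotopyOfEq _ _ ?_⟩
  apply (Qh_map_bijective K _).injective
  rw [Functor.map_zero, Functor.map_zero,
    ← cancel_mono ((quotientCompQhIso C).hom.app L), quotientCompQhIso_hom_naturality, hf]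
  simp

/-- The objects of the derived category that are represented by bounded above complexes of
projective objects. -/
def DerivedCategory.boundedAboveProjective : ObjectProperty (DerivedCategory C) := fun Y =>
  ∃ (K : CochainComplex C ℤ) (a : ℤ), K.IsStrictlyLE a ∧ (∀ i, Projective (K.X i)) ∧
    Nonempty (Q.obj K ≅ Y)

instance : (boundedAboveProjective (C := C)).IsClosedUnderIsomorphisms where
  of_iso := by
    rintro X Y e ⟨K, a, h1, h2, ⟨e'⟩⟩
    exact ⟨K, a, h1, h2, ⟨e' ≪≫ e⟩⟩

/-- The first morphism lifts to a chain map, whose mapping cone has terms `Kⁱ⁺¹ ⊞ Lⁱ` and represents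
the third vertex. -/
theorem DerivedCategory.boundedAboveProjective_of_distTriang (T : Pretriangulated.Triangle
    (DerivedCategory C)) (hT : T ∈ Pretriangulated.distinguishedTriangles)
    (h₁ : boundedAboveProjective T.obj₁) (h₂ : boundedAboveProjective T.obj₂) :
    boundedAboveProjective T.obj₃ := by
  obtain ⟨K, a, hKa, hK, ⟨e⟩⟩ := h₁
  obtain ⟨L, b, hLb, hL, ⟨e'⟩⟩ := h₂
  have := CochainComplex.isKProjective_of_projective K a
  obtain ⟨f, hf⟩ := CochainComplex.IsKProjective.exists_Q_map_eq (e.hom ≫ T.mor₁ ≫ e'.inv)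
  refine ⟨CochainComplex.mappingCone f, max a b, ?_, fun i => ?_, ?_⟩
  · rw [CochainComplex.isStrictlyLE_iff]
    intro i hi
    rw [CochainComplex.mappingCone.isZero_X_iff]
    exact ⟨K.isZero_of_isStrictlyLE a _ (by lia), L.isZero_of_isStrictlyLE b _ (by lia)⟩
  · exact Projective.of_iso (HomologicalComplex.homotopyCofiber.XIsoBiprod f i (i + 1) rfl).symm
      inferInstance
  · have := Pretriangulated.isoTriangleOfIso₁₂ _ T
      (mappingCone_triangle_distinguished f) hT e e' (by
        change Q.map f ≫ e'.hom = e.hom ≫ T.mor₁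
        rw [hf]
        simp)
    exact ⟨Pretriangulated.Triangle.π₃.mapIso this⟩

/-- Coproducts of a bounded above complex of projective objects give coproducts in the derived
category. -/
theorem DerivedCategory.boundedAboveProjective.exists_isColimit {Z : DerivedCategory C}
    (hZ : boundedAboveProjective Z) (J : Type u) [HasColimitsOfShape (Discrete J) C] :
    ∃ c : Cofan fun _ : J => Z, Nonempty (IsColimit c) := by
  obtain ⟨K, a, hKa, hK, ⟨e⟩⟩ := hZ
  have := CochainComplex.isKProjective_of_projective K a
  let hc := coproductIsCoproduct fun _ : J => K
  set c := Cofan.mk (∐ fun _ : J => K) (Sigma.ι fun _ : J => K)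
  let hcn (n : ℤ) : IsColimit (Cofan.mk (c.pt.X n) fun j => (c.inj j).f n) :=
    isColimitCofanMkObjOfIsColimit (HomologicalComplex.eval C (ComplexShape.up ℤ) n) _ c.inj hc
  have hp (n : ℤ) : Projective (c.pt.X n) :=
    Projective.of_iso ((colimit.isColimit _).coconePointUniqueUpToIso (hcn n))
      (inferInstance : Projective (∐ fun _ : J => K.X n))
  have hle : c.pt.IsStrictlyLE a := by
    rw [CochainComplex.isStrictlyLE_iff]
    intro i hi
    rw [IsZero.iff_id_eq_zero]
    exact Cofan.IsColimit.hom_ext (hcn i) _ _ fun j =>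
      (K.isZero_of_isStrictlyLE a i hi).eq_of_src _ _
  have := CochainComplex.isKProjective_of_projective c.pt a
  -- Existence: lift each `f j` to a chain map out of `K` and use the coproduct of complexes.
  -- Uniqueness: null-homotopies on the summands assemble to one on the coproduct, which is
  -- K-projective too.
  have key (T : DerivedCategory C) (f : J → (Z ⟶ T)) :
      ∃! g : Q.obj c.pt ⟶ T, ∀ j, (e.inv ≫ Q.map (c.inj j)) ≫ g = f j := by
    obtain ⟨L, ⟨eT⟩⟩ : ∃ L, Nonempty (Q.obj L ≅ T) := ⟨_, ⟨Q.objObjPreimageIso T⟩⟩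
    choose φ hφ using fun j => CochainComplex.IsKProjective.exists_Q_map_eq (e.hom ≫ f j ≫ eT.inv)
    refine ⟨Q.map (Cofan.IsColimit.desc hc φ) ≫ eT.hom, fun j => ?_, fun g hg => ?_⟩
    · rw [Category.assoc, ← Q.map_comp_assoc, Cofan.IsColimit.fac, hφ]
      simp
    · obtain ⟨γ, hγ⟩ := CochainComplex.IsKProjective.exists_Q_map_eq (g ≫ eT.inv)
      have h0 : Q.map (γ - Cofan.IsColimit.desc hc φ) = 0 := by
        obtain ⟨H⟩ := CochainComplex.nonempty_homotopy_zero_of_isColimit hc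
          (γ - Cofan.IsColimit.desc hc φ) fun j =>
            CochainComplex.IsKProjective.nonempty_homotopy_of_Q_map_eq_zero _ (by
              rw [Preadditive.comp_sub, Functor.map_sub, Cofan.IsColimit.fac, hφ, Functor.map_comp,
                hγ, ← hg j]
              simp)
        have := (quotientCompQhIso C).hom.naturality (γ - Cofan.IsColimit.desc hc φ)
        rw [← cancel_epi ((quotientCompQhIso C).hom.app c.pt), ← this, Functor.comp_map,
          HomotopyCategory.eq_of_homotopy _ _ H]
        simp
      rw [Functor.map_sub, sub_eq_zero] at h0
      rw [← h0, hγ]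
      simp
  choose g hg hg' using key
  exact ⟨Cofan.mk (Q.obj c.pt) fun j => e.inv ≫ Q.map (c.inj j),
    ⟨Cofan.IsColimit.mk _ (fun t => g t.pt t.inj) (fun t j => hg t.pt t.inj j)
      fun t m hm => hg' _ _ m hm⟩⟩

end BoundedAboveProjective

/-! ### Modules of finite length with nilpotent action of an ideal -/

section NilpotentFiniteLength

/-- An `A`-module has finite length and is killed by all sufficiently long products of elements of
the ideal `I`. -/
structure IsNilpotentFiniteLength {A : Type*} [Ring A] (I : Ideal A) (M : Type*) [AddCommGroup M]
    [Module A M] : Prop where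
  isFiniteLength : IsFiniteLength A M
  exists_prod_smul_eq_zero : ∃ N : ℕ, ∀ l : List A, (∀ a ∈ l, a ∈ I) → l.length = N →
    ∀ m : M, l.prod • m = 0

namespace IsNilpotentFiniteLength

variable {A : Type*} [Ring A] {I : Ideal A} {M M' M'' : Type*} [AddCommGroup M] [Module A M]
  [AddCommGroup M'] [Module A M'] [AddCommGroup M''] [Module A M'']

theorem of_subsingleton [Subsingleton M] : IsNilpotentFiniteLength I M :=
  ⟨.of_subsingleton, 0, fun _ _ _ _ => Subsingleton.elim _ _⟩

/-- In a product of `N + N'` factors, the last `N'` act first and push `m` into the range of `f`;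
the first `N` then kill it. -/
theorem of_range_eq_ker (hM' : IsNilpotentFiniteLength I M') (hM'' : IsNilpotentFiniteLength I M'')
    (f : M' →ₗ[A] M) (g : M →ₗ[A] M'') (h : LinearMap.range f = LinearMap.ker g) :
    IsNilpotentFiniteLength I M := by
  obtain ⟨h1, N, hN⟩ := hM'
  obtain ⟨h2, N', hN'⟩ := hM''
  rw [isFiniteLength_iff_isNoetherian_isArtinian] at h1 h2
  obtain ⟨_, _⟩ := h1
  obtain ⟨_, _⟩ := h2
  refine ⟨isFiniteLength_iff_isNoetherian_isArtinian.2 ⟨isNoetherian_of_range_eq_ker f g h,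
    isArtinian_of_range_eq_ker f g h⟩, N + N', fun l hl hlen m => ?_⟩
  have h3 : (l.drop N).prod • m ∈ LinearMap.ker g := by
    rw [LinearMap.mem_ker, map_smul]
    exact hN' _ (fun a ha => hl a (List.mem_of_mem_drop ha)) (by simp [hlen]) _
  rw [← h] at h3
  obtain ⟨m', hm'⟩ := h3
  rw [← List.take_append_drop N l, List.prod_append, mul_smul, ← hm', ← map_smul,
    hN _ (fun a ha => hl a (List.mem_of_mem_take ha)) (by simp [hlen]), map_zero]

theorem of_injective (hM : IsNilpotentFiniteLength I M) (f : M' →ₗ[A] M)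
    (hf : Function.Injective f) : IsNilpotentFiniteLength I M' :=
  of_range_eq_ker (of_subsingleton (M := PUnit)) hM 0 f (by
    rw [LinearMap.range_zero, LinearMap.ker_eq_bot.2 hf])

theorem of_surjective (hM : IsNilpotentFiniteLength I M) (f : M →ₗ[A] M')
    (hf : Function.Surjective f) : IsNilpotentFiniteLength I M' :=
  of_range_eq_ker hM (of_subsingleton (M := PUnit)) f 0 (by
    rw [LinearMap.ker_zero, LinearMap.range_eq_top.2 hf])

end IsNilpotentFiniteLength

/-- Submodules of a module over a ring `B` are also submodules over a ring mapping to `B`. -/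
def Submodule.ofRingHom {A B M : Type*} [Ring A] [Ring B] [AddCommGroup M] [Module A M]
    [Module B M] (f : A →+* B) (h : ∀ (a : A) (m : M), f a • m = a • m) :
    Submodule B M ↪o Submodule A M where
  toFun N :=
    { N.toAddSubmonoid with smul_mem' := fun a m hm => by rw [← h]; exact N.smul_mem _ hm }
  inj' N N' h := by
    ext x
    exact (SetLike.ext_iff.1 h x :)
  map_rel_iff' := Iff.rfl

/-- Chain conditions pass to `B`-submodules because they embed in the `A`-submodules. Besides a
quotient map, this serves for `k → A`. -/
theorem IsFiniteLength.of_ringHom {A B M : Type*} [Ring A] [Ring B] [AddCommGroup M] [Module A M]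
    [Module B M] (f : A →+* B) (h : ∀ (a : A) (m : M), f a • m = a • m)
    (hM : IsFiniteLength A M) : IsFiniteLength B M := by
  rw [isFiniteLength_iff_isNoetherian_isArtinian] at hM ⊢
  obtain ⟨_, _⟩ := hM
  have h := (Submodule.ofRingHom f h).strictMono
  exact ⟨isNoetherian_iff'.2 h.wellFoundedGT, h.wellFoundedLT⟩

theorem IsNilpotentFiniteLength.of_ringHom {A B M : Type*} [Ring A] [Ring B] [AddCommGroup M]
    [Module A M] [Module B M] (f : A →+* B) (hf : Function.Surjective f)
    (h : ∀ (a : A) (m : M), f a • m = a • m) {I : Ideal A} {J : Ideal B}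
    (hIJ : J.comap f ≤ I) (hM : IsNilpotentFiniteLength I M) : IsNilpotentFiniteLength J M := by
  obtain ⟨h1, N, hN⟩ := hM
  refine ⟨h1.of_ringHom f h, N, fun l hl hlen m => ?_⟩
  have hσ := Function.surjInv_eq hf
  have h2 : (l.map (Function.surjInv hf)).map f = l := by
    rw [List.map_map]
    exact (List.map_congr_left fun b _ => hσ b).trans (List.map_id l)
  rw [← h2, ← map_list_prod, h]
  refine hN _ (fun a ha => ?_) (by simpa using hlen) m
  obtain ⟨b, hb, rfl⟩ := List.mem_map.1 ha
  exact hIJ (by rw [Ideal.mem_comap, hσ]; exact hl b hb)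

end NilpotentFiniteLength

/-! ### Modules with nilpotent action of the augmentation ideal -/

section Augmentation

variable {k : Type u} [Field k] {A : Type u} [Ring A] [Algebra k A] (ε : A →ₐ[k] k)

theorem isNilpotentFiniteLength_residue :
    IsNilpotentFiniteLength (RingHom.ker ε)
      ((ModuleCat.restrictScalars ε.toRingHom).obj (ModuleCat.of k k)) := by
  let _ : Module k ((ModuleCat.restrictScalars ε.toRingHom).obj (ModuleCat.of k k)) :=
    inferInstanceAs (Module k k)
  refine ⟨IsFiniteLength.of_ringHom (A := k) (algebraMap k A) (fun c m => ?_) ?_, 1,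
    fun l hl hlen m => ?_⟩
  · change ε (algebraMap k A c) * (show k from m) = c * (show k from m)
    rw [AlgHom.commutes]
    rfl
  · exact isFiniteLength_iff_isNoetherian_isArtinian.2
      ⟨inferInstanceAs (IsNoetherian k k), inferInstanceAs (IsArtinian k k)⟩
  · obtain ⟨a, rfl⟩ := List.length_eq_one_iff.1 hlen
    rw [List.prod_singleton]
    have ha : ε a = 0 := hl a (by simp)
    exact (congrArg (fun c : k => c * (show k from m)) ha).trans (zero_mul _)

/-- A simple module on which the augmentation ideal acts nilpotently is the residue module. -/
theorem nonempty_residue_equiv_of_isSimpleModule {M : Type u} [AddCommGroup M] [Module A M]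
    [IsSimpleModule A M] (hM : IsNilpotentFiniteLength (RingHom.ker ε) M) :
    Nonempty ((ModuleCat.restrictScalars ε.toRingHom).obj (ModuleCat.of k k) ≃ₗ[A] M) := by
  classical
  have : Nontrivial M := IsSimpleModule.nontrivial A M
  -- Take the least `N` such that all products of `N` elements of the ideal act as zero. It is
  -- positive as `M ≠ 0`; a nonzero value `v` of some product of `N - 1` elements is killed by one
  -- more.
  obtain ⟨v, hv, hv'⟩ : ∃ v : M, v ≠ 0 ∧ ∀ a, ε a = 0 → a • v = 0 := by
    have hex := hM.exists_prod_smul_eq_zero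
    obtain ⟨m₀, hm₀⟩ := exists_ne (0 : M)
    obtain h0 | ⟨n, hn⟩ := Nat.eq_zero_or_eq_succ_pred (Nat.find hex) |>.imp_right fun h =>
      (⟨_, h⟩ : ∃ n, Nat.find hex = n + 1)
    · exact absurd (by simpa using Nat.find_spec hex [] (by simp) h0.symm m₀) hm₀
    · have h1 := Nat.find_min hex (m := n) (by lia)
      push Not at h1
      obtain ⟨l, hl, hlen, m, hm⟩ := h1
      refine ⟨l.prod • m, hm, fun a ha => ?_⟩
      rw [← mul_smul, ← List.prod_cons]
      refine Nat.find_spec hex _ ?_ (by rw [List.length_cons, hlen, hn]) m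
      intro b hb
      obtain rfl | hb := List.mem_cons.1 hb
      · exact ha
      · exact hl b hb
  let φ : (ModuleCat.restrictScalars ε.toRingHom).obj (ModuleCat.of k k) →ₗ[A] M :=
    { toFun := fun c => algebraMap k A c • v
      map_add' := fun c c' => by
        rw [← add_smul]
        exact congrArg (· • v) (map_add (algebraMap k A) c c')
      map_smul' := fun a c => by
        rw [RingHom.id_apply, ← mul_smul, ← sub_eq_zero, ← sub_smul]
        apply hv'
        have key (c : k) : ε (algebraMap k A (ε a * c) - a * algebraMap k A c) = 0 := by simp
        exact key c }
  refine ⟨LinearEquiv.ofBijective φ ⟨?_, ?_⟩⟩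
  · rw [injective_iff_map_eq_zero]
    intro (c : k) (hc : algebraMap k A c • v = 0)
    by_contra hc0
    apply hv
    have h := congrArg (algebraMap k A c⁻¹ • ·) hc
    simp only [← mul_smul, ← map_mul, smul_zero] at h
    rwa [inv_mul_cancel₀ hc0, map_one, one_smul] at h
  · refine LinearMap.range_eq_top.1 ((eq_bot_or_eq_top (LinearMap.range φ)).resolve_left fun h => ?_)
    apply hv
    have h1 : φ (1 : k) ∈ LinearMap.range φ := ⟨_, rfl⟩
    rw [h, Submodule.mem_bot] at h1
    have h2 : φ (1 : k) = algebraMap k A 1 • v := rfl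
    rwa [h2, map_one, one_smul] at h1

/-- A triangulated subcategory which contains the residue module contains all modules of finite
length on which the augmentation ideal acts nilpotently. -/
theorem prop_singleFunctor_obj_of_isNilpotentFiniteLength
    [HasDerivedCategory.{w} (ModuleCat.{u} A)]
    (P : ObjectProperty (DerivedCategory (ModuleCat.{u} A))) [P.IsTriangulated]
    [P.IsClosedUnderIsomorphisms]
    (hk : P ((DerivedCategory.singleFunctor (ModuleCat.{u} A) 0).obj
      ((ModuleCat.restrictScalars ε.toRingHom).obj (ModuleCat.of k k))))
    (M : Type u) [AddCommGroup M] [Module A M] (hM : IsNilpotentFiniteLength (RingHom.ker ε) M) :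
    P ((DerivedCategory.singleFunctor (ModuleCat.{u} A) 0).obj (ModuleCat.of A M)) := by
  have h := hM.isFiniteLength
  induction h with
  | @of_subsingleton M _ _ _ =>
    exact P.prop_of_isZero ((DerivedCategory.singleFunctor _ 0).map_isZero
      (ModuleCat.isZero_of_subsingleton (ModuleCat.of A M)))
  | @of_simple_quotient M _ _ N _ _ ih =>
    have h1 := ih (hM.of_injective N.subtype N.injective_subtype)
    obtain ⟨e⟩ := nonempty_residue_equiv_of_isSimpleModule ε
      (hM.of_surjective N.mkQ N.mkQ_surjective)
    have h2 := P.prop_of_iso ((DerivedCategory.singleFunctor (ModuleCat.{u} A) 0).mapIso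
      e.toModuleIso) hk
    let S : ShortComplex (ModuleCat.{u} A) :=
      { f := ModuleCat.ofHom N.subtype
        g := ModuleCat.ofHom N.mkQ
        zero := by
          ext x
          exact (Submodule.Quotient.mk_eq_zero N).2 x.2 }
    have hS : S.ShortExact :=
      { exact := by
          rw [ShortComplex.moduleCat_exact_iff]
          exact fun x hx => ⟨⟨x, (Submodule.Quotient.mk_eq_zero N).1 hx⟩, rfl⟩
        mono_f := (ModuleCat.mono_iff_injective _).2 N.injective_subtype
        epi_g := (ModuleCat.epi_iff_surjective _).2 N.mkQ_surjective }
    exact P.ext_of_isTriangulatedClosed₂ _ hS.singleTriangle_distinguished h1 h2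

end Augmentation

/-! ### Complexes with bounded cohomology of finite length -/

section BoundedFiniteLength

open Limits

/-- Complexes with bounded cohomology, of finite length and with nilpotent action of `I`. -/
def boundedNilpotentFiniteLength {A : Type u} [Ring A] (I : Ideal A) :
    ObjectProperty (CochainComplex (ModuleCat.{u} A) ℤ) := fun K =>
  (∀ i, IsNilpotentFiniteLength I (K.homology i)) ∧
    ∃ a b : ℤ, ∀ i, i < a ∨ b ≤ i → IsZero (K.homology i)

variable {A : Type u} [Ring A] (I : Ideal A)

instance : (boundedNilpotentFiniteLength I).IsClosedUnderIsomorphisms where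
  of_iso := by
    rintro K L e ⟨h, a, b, hab⟩
    let e' (i : ℤ) : K.homology i ≅ L.homology i :=
      (HomologicalComplex.homologyFunctor _ _ i).mapIso e
    exact ⟨fun i => (h i).of_surjective (e' i).toLinearEquiv.toLinearMap
      (e' i).toLinearEquiv.surjective, a, b, fun i hi => (hab i hi).of_iso (e' i).symm⟩

/-- Read off from `Hⁱ(X₂) → Hⁱ(X₃) → Hⁱ⁺¹(X₁)`; the connecting map explains the lower bound `a - 1`.
-/
theorem boundedNilpotentFiniteLength_of_shortExact
    (S : ShortComplex (CochainComplex (ModuleCat.{u} A) ℤ)) (hS : S.ShortExact)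
    (h₁ : boundedNilpotentFiniteLength I S.X₁) (h₂ : boundedNilpotentFiniteLength I S.X₂) :
    boundedNilpotentFiniteLength I S.X₃ := by
  obtain ⟨h₁, a, b, hab⟩ := h₁
  obtain ⟨h₂, a', b', hab'⟩ := h₂
  refine ⟨fun i => ?_, min (a - 1) a', max b b', fun i hi => ?_⟩
  · exact (h₂ i).of_range_eq_ker (h₁ (i + 1)) _ _
      ((ShortComplex.moduleCat_exact_iff_range_eq_ker _).1 (hS.homology_exact₃ i (i + 1) rfl))
  · exact (hS.homology_exact₃ i (i + 1) rfl).isZero_of_both_zeros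
      ((hab' i (by lia)).eq_of_src _ _) ((hab (i + 1) (by lia)).eq_of_tgt _ _)

theorem boundedNilpotentFiniteLength_of_projectiveResolution {M : ModuleCat.{u} A}
    (hM : IsNilpotentFiniteLength I M) (P : ProjectiveResolution M) :
    boundedNilpotentFiniteLength I P.cochainComplex := by
  have hz (i : ℤ) (hi : i ≠ 0) : IsZero (P.cochainComplex.homology i) :=
    (HomologicalComplex.isZero_single_obj_homology (ComplexShape.up ℤ) 0 M i hi).of_iso
      (isoOfQuasiIsoAt P.π' i)
  refine ⟨fun i => ?_, 0, 1, fun i hi => hz i (by lia)⟩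
  obtain rfl | hi := eq_or_ne i 0
  · let e : M ≅ P.cochainComplex.homology 0 :=
      (HomologicalComplex.singleObjHomologySelfIso (ComplexShape.up ℤ) 0 M).symm ≪≫
        (isoOfQuasiIsoAt P.π' 0).symm
    exact hM.of_surjective e.toLinearEquiv.toLinearMap e.toLinearEquiv.surjective
  · have := ModuleCat.subsingleton_of_isZero (hz i hi)
    exact .of_subsingleton

instance restrictScalars_preservesHomology {B : Type u} [Ring B] (f : A →+* B) :
    (ModuleCat.restrictScalars.{u} f).PreservesHomology :=
  ((Functor.exact_tfae (ModuleCat.restrictScalars.{u} f)).out 1 2).1 fun S hS => by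
    rw [ShortComplex.moduleCat_exact_iff] at hS ⊢
    exact hS

/-- The cohomology of a complex can be computed after restriction of scalars. -/
noncomputable def restrictScalarsHomologyIso {B : Type u} [Ring B] (f : A →+* B)
    (K : CochainComplex (ModuleCat.{u} B) ℤ) (i : ℤ) :
    (((ModuleCat.restrictScalars f).mapHomologicalComplex _).obj K).homology i ≅
      (ModuleCat.restrictScalars f).obj (K.homology i) :=
  (K.sc i).mapHomologyIso (ModuleCat.restrictScalars f)

/-- If the complex of projectives `K` over `A` has bounded cohomology of finite length, so has
`B ⊗_A K`, where `B` is the quotient of `A` by the end of a central chain. -/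
theorem boundedNilpotentFiniteLength_baseChange {B : Type u} [Ring B] (f : A →+* B)
    (hf : Function.Surjective f) (hchain : CentralChain A (RingHom.ker f))
    (J : Ideal B) (hIJ : J.comap f ≤ I) (K : CochainComplex (ModuleCat.{u} A) ℤ)
    [∀ i, Projective (K.X i)] (hK : boundedNilpotentFiniteLength I K) :
    boundedNilpotentFiniteLength J
      (((baseChangeFunctor f).mapHomologicalComplex (ComplexShape.up ℤ)).obj K) := by
  -- The finiteness is first obtained over `A`, for `K/(ker f)K`, and then moved to `B ⊗_A K`, which
  -- is the same complex after restriction of scalars.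
  obtain ⟨h, a, b, hab⟩ := hchain.reductionComplex_mem K (boundedNilpotentFiniteLength I) hK
    (boundedNilpotentFiniteLength_of_shortExact I)
  set X := ((baseChangeFunctor f).mapHomologicalComplex (ComplexShape.up ℤ)).obj K with hX
  let e (i : ℤ) : (reductionComplex (RingHom.ker f) K).homology i ≅
      (ModuleCat.restrictScalars f).obj (X.homology i) :=
    (HomologicalComplex.homologyFunctor _ _ i).mapIso
      ((NatIso.mapHomologicalComplex (reductionIsoBaseChange hf) _).app K) ≪≫
      restrictScalarsHomologyIso f X i
  refine ⟨fun i => ?_, a, b, fun i hi => ?_⟩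
  · let _ : Module A (X.homology i) := Module.compHom _ f
    refine IsNilpotentFiniteLength.of_ringHom f hf (fun _ _ => rfl) hIJ (I := I) ?_
    exact (h i).of_surjective (e i).toLinearEquiv.toLinearMap (e i).toLinearEquiv.surjective
  · have h1 := ModuleCat.subsingleton_of_isZero ((hab i hi).of_iso (e i).symm)
    exact @ModuleCat.isZero_of_subsingleton _ _ (X.homology i) h1

/-- A triangulated subcategory which contains the residue module contains all complexes with
bounded cohomology of finite length on which the augmentation ideal acts nilpotently. -/
theorem prop_Q_obj_of_boundedNilpotentFiniteLength {k : Type u} [Field k] [Algebra k A]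
    (ε : A →ₐ[k] k) [HasDerivedCategory.{w} (ModuleCat.{u} A)]
    (P : ObjectProperty (DerivedCategory (ModuleCat.{u} A))) [P.IsTriangulated]
    [P.IsClosedUnderIsomorphisms]
    (hk : P ((DerivedCategory.singleFunctor (ModuleCat.{u} A) 0).obj
      ((ModuleCat.restrictScalars ε.toRingHom).obj (ModuleCat.of k k))))
    (K : CochainComplex (ModuleCat.{u} A) ℤ)
    (hK : boundedNilpotentFiniteLength (RingHom.ker ε) K) : P (DerivedCategory.Q.obj K) := by
  obtain ⟨h, a, b, hab⟩ := hK
  exact DerivedCategory.prop_Q_obj_of_homology P a (b - a).toNat K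
    (fun i hi => hab i (by lia))
    (fun i => prop_singleFunctor_obj_of_isNilpotentFiniteLength ε P hk _ (h i))

end BoundedFiniteLength

/-! ### The residue module as a direct summand -/

theorem CategoryTheory.ProjectiveResolution.exists_epi {C : Type*} [Category* C] [Abelian C]
    {X : C} (P : ProjectiveResolution X) :
    ∃ g : P.cochainComplex.X 0 ⟶ X, Epi g ∧ P.cochainComplex.d (-1) 0 ≫ g = 0 := by
  let g : P.complex.X 0 ⟶ X := P.π.f 0
  have hg : P.complex.d 1 0 ≫ g = 0 := P.complex_d_comp_π_f_zero
  have : Epi g := inferInstanceAs (Epi (P.π.f 0))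
  refine ⟨(P.cochainComplexXIso 0 0).hom ≫ g, epi_comp _ _, ?_⟩
  rw [P.cochainComplex_d (-1) 0 1 0]
  simp [hg]

section Residue

open Limits

variable {k : Type u} [Field k] {B : Type u} [Ring B] [Algebra k B] (ε : B →ₐ[k] k)

/-- If the complex `K` vanishes in positive degrees and surjects onto the residue module `T`, then
`T` is a direct summand of the reduction of `K` modulo the augmentation ideal. -/
theorem nonempty_retract_reductionComplex {T : ModuleCat.{u} B} (e : T ≃+ k)
    (he : ∀ (b : B) (t : T), e (b • t) = ε b * e t) (K : CochainComplex (ModuleCat.{u} B) ℤ)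
    [K.IsStrictlyLE 0] (φ : K.X 0 ⟶ T) (hφ : K.d (-1) 0 ≫ φ = 0) (hsurj : Function.Surjective φ) :
    Nonempty (Retract ((HomologicalComplex.single (ModuleCat.{u} B) (ComplexShape.up ℤ) 0).obj T)
      (reductionComplex (RingHom.ker ε) K)) := by
  obtain ⟨v, hv⟩ := hsurj (e.symm 1)
  let ρ' : (K.X 0 ⧸ (RingHom.ker ε • ⊤ : Submodule B (K.X 0))) →ₗ[B] T :=
    Submodule.liftQ _ φ.hom (by
      rw [Submodule.smul_le]
      intro b hb x _
      rw [LinearMap.mem_ker, map_smul, ← e.map_eq_zero_iff, he, RingHom.mem_ker.1 hb, zero_mul])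
  let ρ : (reductionComplex (RingHom.ker ε) K).X 0 ⟶ T := ModuleCat.ofHom ρ'
  -- The class of the lift `v` of `1` is annihilated by the augmentation ideal, so it spans a copy
  -- of `T`. The section is a chain map because `K` vanishes in degree `1`, the retraction because
  -- `φ` kills the boundaries.
  let σ' : T →ₗ[B] (K.X 0 ⧸ (RingHom.ker ε • ⊤ : Submodule B (K.X 0))) :=
    { toFun := fun t => algebraMap k B (e t) • Submodule.Quotient.mk v
      map_add' := fun t t' => by rw [map_add, map_add, add_smul]
      map_smul' := fun b t => by
        rw [RingHom.id_apply, ← mul_smul, ← sub_eq_zero, ← sub_smul]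
        exact reduction_smul_eq_zero (M := K.X 0) (by simp [RingHom.mem_ker, he]) _ }
  let σ : T ⟶ (reductionComplex (RingHom.ker ε) K).X 0 := ModuleCat.ofHom σ'
  refine ⟨⟨HomologicalComplex.mkHomFromSingle σ ?_, HomologicalComplex.mkHomToSingle ρ ?_, ?_⟩⟩
  · intro i hi
    have h : IsZero (K.X i) := K.isZero_of_isStrictlyLE 0 i (by simp at hi; lia)
    have h' : IsZero ((reductionComplex (RingHom.ker ε) K).X i) :=
      (reduction (RingHom.ker ε)).map_isZero h
    exact h'.eq_of_tgt _ _
  · intro i hi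
    obtain rfl : i = -1 := by simp at hi; lia
    ext x
    obtain ⟨x, rfl⟩ := Submodule.Quotient.mk_surjective _ x
    exact ConcreteCategory.congr_hom hφ x
  · apply HomologicalComplex.to_single_hom_ext
    have h : σ ≫ ρ = 𝟙 _ := by
      ext t
      change φ.hom (algebraMap k B (e t) • v) = t
      rw [map_smul, show φ.hom v = e.symm 1 from hv, ← e.injective.eq_iff, he, e.apply_symm_apply, mul_one, ε.commutes]
      rfl
    rw [HomologicalComplex.comp_f, HomologicalComplex.mkHomFromSingle_f,
      HomologicalComplex.mkHomToSingle_f, Category.assoc, reassoc_of% h, Iso.hom_inv_id]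
    rfl

/-- For a projective resolution `P` of the residue module, seen as a module over `A`, the residue
module over `B` is a direct summand of the reduction of `B ⊗_A P` modulo the augmentation ideal. -/
theorem nonempty_retract_reductionComplex_baseChange {A : Type u} [Ring A] (f : A →+* B)
    {T : ModuleCat.{u} B} (e : T ≃+ k) (he : ∀ (b : B) (t : T), e (b • t) = ε b * e t)
    (P : ProjectiveResolution ((ModuleCat.restrictScalars f).obj T)) :
    Nonempty (Retract ((HomologicalComplex.single (ModuleCat.{u} B) (ComplexShape.up ℤ) 0).obj T)
      (reductionComplex (RingHom.ker ε)
        (((baseChangeFunctor f).mapHomologicalComplex (ComplexShape.up ℤ)).obj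
          P.cochainComplex))) := by
  obtain ⟨g, hepi, hg⟩ := P.exists_epi
  have hgsurj : Function.Surjective g := (ModuleCat.epi_iff_surjective g).1 hepi
  let g' : P.cochainComplex.X 0 →ₛₗ[f] T :=
    { toFun := fun x => g x
      map_add' := fun x y => map_add g.hom x y
      map_smul' := fun a x => map_smul g.hom a x }
  have : CochainComplex.IsStrictlyLE (((baseChangeFunctor f).mapHomologicalComplex
      (ComplexShape.up ℤ)).obj P.cochainComplex) 0 := by
    rw [CochainComplex.isStrictlyLE_iff]
    exact fun i hi => (baseChangeFunctor f).map_isZero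
      (P.cochainComplex.isZero_of_isStrictlyLE 0 i hi)
  refine nonempty_retract_reductionComplex ε e he _ (ModuleCat.ofHom (BalancedTensor.lift f g'))
    ?_ fun t => ?_
  · ext1
    refine BalancedTensor.hom_ext f fun b m => ?_
    have h : g (P.cochainComplex.d (-1) 0 m) = 0 := ConcreteCategory.congr_hom hg m
    change b • g (P.cochainComplex.d (-1) 0 m) = 0
    exact (congrArg (fun t : T => b • t) h).trans (smul_zero (A := T) b)
  · obtain ⟨x, hx⟩ := hgsurj t
    refine ⟨BalancedTensor.unit f _ x, ?_⟩
    exact (one_smul B (g' x)).trans hx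

end Residue

section Generation

open Limits DerivedCategory

variable {B : Type u} [Ring B] [HasDerivedCategory.{w} (ModuleCat.{u} B)]

/-- The reduction modulo the end of a central chain of a complex of projectives belongs to the
triangulated subcategory generated by this complex. -/
theorem CentralChain.prop_Q_obj_reductionComplex {J : Ideal B} (hJ : CentralChain B J)
    (P : ObjectProperty (DerivedCategory (ModuleCat.{u} B)))
    [P.IsClosedUnderIsomorphisms] (hP : ∀ T ∈ Pretriangulated.distinguishedTriangles,
      P (Pretriangulated.Triangle.obj₁ T) → P T.obj₂ → P T.obj₃)
    (K : CochainComplex (ModuleCat.{u} B) ℤ)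
    [∀ i, Projective (K.X i)] (hK : P (Q.obj K)) : P (Q.obj (reductionComplex J K)) :=
  -- Only closure under the third vertex of a triangle is used, so that `boundedAboveProjective` is
  -- also an admissible `P`.
  hJ.reductionComplex_mem K (P.inverseImage Q) hK fun _ hS h₁ h₂ =>
    hP _ (triangleOfSES_distinguished hS) h₁ h₂

end Generation

/-! ### Comparison of the generated subcategories -/

section Comparison

variable (k : Type u) [Field k] (n d : ℕ)

theorem envQuotientMap_comp_ker :
    (RingHom.ker (quotientAugmentation k n d)).comap (envQuotientMap k n d).toRingHom ≤
      RingHom.ker ((quotientAugmentation k n d).comp (envQuotientMap k n d)) :=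
  fun _ hx => hx

variable [HasDerivedCategory.{w} (ModuleCat.{u} (EnvQuotient k n d))]

/-- The resolution of `k` over `U` has cohomology `k` in degree `0`; the central chain for `I`
carries its finiteness over to `U/I`, where dévissage applies. -/
theorem prop_derivedBaseChange_envResidueModule (hd : 1 ≤ d)
    (P : ObjectProperty (DerivedCategory (ModuleCat.{u} (EnvQuotient k n d)))) [P.IsTriangulated]
    [P.IsClosedUnderIsomorphisms]
    (hk : P ((DerivedCategory.singleFunctor _ 0).obj (quotientResidueModule k n d))) :
    P (derivedBaseChange (envQuotientMap k n d).toRingHom (envResidueModule k n d)) := by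
  refine prop_Q_obj_of_boundedNilpotentFiniteLength (quotientAugmentation k n d) P hk _ ?_
  refine boundedNilpotentFiniteLength_baseChange _ (envQuotientMap k n d).toRingHom
    envQuotientMap_surjective (centralChain_ker_envQuotientMap hd) _
    (envQuotientMap_comp_ker k n d) _
    (boundedNilpotentFiniteLength_of_projectiveResolution _ ?_ _)
  exact isNilpotentFiniteLength_residue ((quotientAugmentation k n d).comp (envQuotientMap k n d))

/-- The residue module is a retract of an object `Z` in the triangulated subcategory generated by
the derived tensor product. -/
theorem exists_retract_quotientResidueModule (hd : 1 ≤ d) :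
    ∃ Z : DerivedCategory (ModuleCat.{u} (EnvQuotient k n d)),
      Nonempty (Retract ((DerivedCategory.singleFunctor _ 0).obj (quotientResidueModule k n d)) Z) ∧
      DerivedCategory.boundedAboveProjective Z ∧
      ∀ (P : ObjectProperty (DerivedCategory (ModuleCat.{u} (EnvQuotient k n d))))
        [P.IsTriangulated] [P.IsClosedUnderIsomorphisms],
        P (derivedBaseChange (envQuotientMap k n d).toRingHom (envResidueModule k n d)) → P Z := by
  have hchain := centralChain_ker_quotientAugmentation (k := k) (n := n) hd
  set K := ((baseChangeFunctor (envQuotientMap k n d).toRingHom).mapHomologicalComplex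
    (ComplexShape.up ℤ)).obj (projectiveResolution (envResidueModule k n d)).cochainComplex with hK
  have hproj : ∀ i, Projective (K.X i) := fun i =>
    baseChangeFunctor_obj_projective (envQuotientMap k n d).toRingHom
      ((projectiveResolution (envResidueModule k n d)).cochainComplex.X i)
  have hle : CochainComplex.IsStrictlyLE K 0 := by
    rw [CochainComplex.isStrictlyLE_iff]
    exact fun i hi => (baseChangeFunctor (envQuotientMap k n d).toRingHom).map_isZero
      (CochainComplex.isZero_of_isStrictlyLE _ 0 i hi)
  refine ⟨DerivedCategory.Q.obj
    (reductionComplex (RingHom.ker (quotientAugmentation k n d)) K), ?_, ?_, ?_⟩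
  · obtain ⟨r⟩ := nonempty_retract_reductionComplex_baseChange (quotientAugmentation k n d)
      (envQuotientMap k n d).toRingHom (T := quotientResidueModule k n d) (AddEquiv.refl k)
      (fun _ _ => rfl) (projectiveResolution (envResidueModule k n d))
    exact ⟨r.map DerivedCategory.Q⟩
  -- The terms of the reduced complex need not be projective; it is as an iterated cone that it is
  -- isomorphic in the derived category to a bounded above complex of projectives.
  · exact hchain.prop_Q_obj_reductionComplex _
      DerivedCategory.boundedAboveProjective_of_distTriang K ⟨K, 0, hle, hproj, ⟨Iso.refl _⟩⟩
  · intro P _ _ hP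
    exact hchain.prop_Q_obj_reductionComplex P P.ext_of_isTriangulatedClosed₃ K hP

end Comparison

section Envelopes

open Limits Pretriangulated

variable {C : Type*} [Category* C] [HasZeroObject C] [HasShift C ℤ] [Preadditive C]
  [∀ (n : ℤ), (shiftFunctor C n).Additive] [Pretriangulated C]

theorem thickSubcategory_le [IsTriangulated C] {X Y : C} (h : thickSubcategory Y X) :
    thickSubcategory X ≤ thickSubcategory Y := by
  unfold thickSubcategory at *
  rw [ObjectProperty.triangEnvelope_le_iff]
  rintro Z ⟨⟩
  exact h

theorem localizingSubcategory_le {X Y : C} (h : localizingSubcategory.{u} Y X) :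
    localizingSubcategory.{u} X ≤ localizingSubcategory.{u} Y :=
  fun _ hZ P hP hY => hZ P hP (h P hP hY)

end Envelopes

theorem mainTheorem7 (k : Type u) [Field k] (n d : ℕ) (hd : 1 ≤ d)
    [HasDerivedCategory.{w} (ModuleCat.{u} (EnvQuotient k n d))] :
    -- `U/I` is the polynomial algebra `k[x₁, …, xₙ]`
    (∃ e : EnvQuotient k n d ≃ₐ[k] MvPolynomial (Fin n) k,
      ∀ i : Fin n, e (envQuotientMap k n d (envGen k n d i)) = MvPolynomial.X i) ∧
    -- `k` and `U/I ⊗^L_U k` generate the same thick subcategory of `D(U/I)`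
    thickSubcategory
        ((DerivedCategory.singleFunctor (ModuleCat.{u} (EnvQuotient k n d)) 0).obj
          (quotientResidueModule k n d)) =
      thickSubcategory
        (derivedBaseChange (envQuotientMap k n d).toRingHom (envResidueModule k n d)) ∧
    -- and the same localizing subcategory of `D(U/I)`
    localizingSubcategory.{u}
        ((DerivedCategory.singleFunctor (ModuleCat.{u} (EnvQuotient k n d)) 0).obj
          (quotientResidueModule k n d)) =
      localizingSubcategory.{u}
        (derivedBaseChange (envQuotientMap k n d).toRingHom (envResidueModule k n d)) := by
  obtain ⟨Z, ⟨r⟩, hZ, hZP⟩ := exists_retract_quotientResidueModule k n d hd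
  refine ⟨⟨(polyEquivEnvQuotient k n d hd).symm, fun i => ?_⟩, ?_, ?_⟩
  · rw [AlgEquiv.symm_apply_eq]
    exact (polyToEnvQuotient_X i).symm
  · refine le_antisymm (thickSubcategory_le ?_) (thickSubcategory_le ?_)
    · unfold thickSubcategory
      exact ObjectProperty.prop_of_retract _ r
        (hZP _ (ObjectProperty.le_triangEnvelope _ _ ((ObjectProperty.singleton_iff _ _).2 rfl)))
    · unfold thickSubcategory
      exact prop_derivedBaseChange_envResidueModule k n d hd _
        (ObjectProperty.le_triangEnvelope _ _ ((ObjectProperty.singleton_iff _ _).2 rfl))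
  · refine le_antisymm (localizingSubcategory_le fun P hP hX => ?_)
      (localizingSubcategory_le fun P hP hX => ?_)
    · have := hP.isTriangulated
      have := hP.isClosedUnderIsomorphisms
      -- The countable coproduct of copies of `Z` feeds the swindle that makes `P` contain its
      -- retract `k`.
      obtain ⟨c, ⟨hc⟩⟩ := hZ.exists_isColimit (ULift.{u} ℕ)
      exact hP.prop_of_retract r (hZP P hX) c hc
    · have := hP.isTriangulated
      have := hP.isClosedUnderIsomorphisms
      exact prop_derivedBaseChange_envResidueModule k n d hd P hX
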